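/- **Conventions.** Let $\mathbb Z_-=\{n\in\mathbb Z: n\le 0\}$. All $\sigma$-fields on a probability space are completed and are essentially separable. A filtration is a non-decreasing family of sub-$\sigma$-fields indexed by $\mathbb Z_-$, or by an infinite subset $D\subset\mathbb Z_-$ (which is order-isomorphic to $\mathbb Z_-$). The natural filtration of a process $Z=(Z_n)$ is $\mathcal F^Z_n=\sigma(Z_k: k\le n)$. * A filtration is *of product type* if it is the natural filtration of a process made of independent random variables. * A filtration $\mathcal F$ is *immersed* in a filtration $\mathcal G$ on the same probability space if, for every index $n$, $\mathcal F_n\subset\mathcal G_n$ and $\mathcal F_n$ is independent of $\mathcal G_{n^-}$ conditionally on $\mathcal F_{n^-}$, where $n^-$ is the index that immediately precedes $n$. * An *isomorphism* from a filtration $\mathcal F$ on $(\Omega,\mathcal A,\mathbb P)$ onto a filtration $\mathcal F'$ on $(\Omega',\mathcal A',\mathbb P')$ is a bijection $\Psi:L^0(\Omega,\mathcal F_\infty,\mathbb P)\to L^0(\Omega',\mathcal F'_\infty,\mathbb P')$, where $\mathcal F_\infty=\bigvee_n\mathcal F_n$ and $\mathcal F'_\infty=\bigvee_n\mathcal F'_n$,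 that preserves the laws of random variables, commutes with Borel functions of sequences of random variables, and is such that, for every $n$, the variables $\Psi(X)$ with $X\in L^0(\Omega,\mathcal F_n,\mathbb P)$ generate $\mathcal F'_n$. * A filtration is *standard* if it is isomorphic to a filtration, on some probability space, that is immersed in a filtration of product type. * Given positive integers $(r_n)_{n\le0}$, a filtration $(\mathcal F_n)_{n\le 0}$ is *$(r_n)$-adic* if, for every $n\le 0$, $\mathcal F_n$ is generated by $\mathcal F_{n-1}$ and some random variable $U_n$ that is independent of $\mathcal F_{n-1}$ and uniformly distributed on a finite set with $r_n$ elements. * A filtration $(\mathcal F_n)_{n\le0}$ is *at the threshold of standardness* if it is not standard and, for every infinite $D\subset\mathbb Z_-$, the extracted filtration $(\mathcal F_n)_{n\in D}$ is standard if and only if $\mathbb Z_-\setminus D$ is infinite. **Theorem.** There exists an (inhomogeneous) Markov process $(Z_n)_{n\le 0}$ on some probability space such that 1. for each $n\le0$, $Z_n$ takes its values in some finite set $F_n$; 2. the random variables $(Z_{2n})_{n\le0}$ are independent; 3. for each $n\le0$, $Z_{2n-1}$ is a deterministic function of $(Z_{2n-2},Z_{2n})$; 4. the natural filtration $(\mathcal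 F^Z_n)_{n\le0}$ is $(r_n)_{n\le0}$-adic for some sequence $(r_n)_{n\le0}$ of positive integers; 5. for every infinite subset $D$ of $\mathbb Z_-$, the filtration $(\mathcal F^Z_n)_{n\in D}$ is standard if and only if $2n-1\notin D$ for infinitely many $n\le 0$. In particular, the filtration $(\mathcal F^Z_{2n-1})_{n\le0}$ is at the threshold of standardness. -/

import Mathlib

open MeasureTheory ProbabilityTheory

namespace BackwardFiltration

/-- The index set `ℤ₋ = {n ∈ ℤ : n ≤ 0}`, with the order inherited from `ℤ`. -/
abbrev NonposInt : Type := {n : ℤ // n ≤ 0}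

/-- The index `n - 1`. -/
def NonposInt.prev (n : NonposInt) : NonposInt := ⟨n.1 - 1, by have := n.2; omega⟩

/-- The even index `2n`. -/
def NonposInt.even (n : NonposInt) : NonposInt := ⟨2 * n.1, by have := n.2; omega⟩

/-- The even index `2n - 2`. -/
def NonposInt.evenPrev (n : NonposInt) : NonposInt := ⟨2 * n.1 - 2, by have := n.2; omega⟩

/-- The odd index `2n - 1`. -/
def NonposInt.odd (n : NonposInt) : NonposInt := ⟨2 * n.1 - 1, by have := n.2; omega⟩

theorem NonposInt.odd_mono : Monotone NonposInt.odd := by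
  intro a b h
  have h' : a.1 ≤ b.1 := h
  change 2 * a.1 - 1 ≤ 2 * b.1 - 1
  omega

section Completion

variable {Ω : Type*} {m0 : MeasurableSpace Ω}

/-- The completion of `m` in the ambient σ-field: the σ-field of all events which are almost surely
equal to an event of `m`. For `m ≤ m0` it is generated by `m` and the negligible events. -/
@[reducible] def completion (μ : Measure Ω) (m : MeasurableSpace Ω) : MeasurableSpace Ω :=
  eventuallyMeasurableSpace m (ae μ) ⊓ m0

theorem measurableSet_completion_iff {μ : Measure Ω} {m : MeasurableSpace Ω} {s : Set Ω} :
    MeasurableSet[completion μ m] s ↔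
      (∃ t, MeasurableSet[m] t ∧ s =ᵐ[μ] t) ∧ MeasurableSet[m0] s := by
  exact MeasurableSpace.measurableSet_inf

theorem completion_mono {μ : Measure Ω} {m₁ m₂ : MeasurableSpace Ω} (h : m₁ ≤ m₂) :
    completion μ m₁ ≤ completion μ m₂ := by
  intro s hs
  rw [measurableSet_completion_iff] at hs ⊢
  obtain ⟨⟨t, ht, hst⟩, hs⟩ := hs
  exact ⟨⟨t, h t ht, hst⟩, hs⟩

theorem completion_le {μ : Measure Ω} {m : MeasurableSpace Ω} : completion μ m ≤ m0 :=
  inf_le_right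

end Completion

section Filtrations

variable {Ω : Type*} {m0 : MeasurableSpace Ω} {ι κ : Type*}

/-- The (completed) natural filtration of a process `Z`:
at time `i` it is the completion of `σ(Z_j : j ≤ i)`. -/
def naturalFiltration [Preorder ι] {E : ι → Type*} [∀ i, MeasurableSpace (E i)]
    (μ : Measure Ω) (Z : ∀ i, Ω → E i) : Filtration ι m0 where
  seq i := completion μ (⨆ j, ⨆ (_ : j ≤ i), MeasurableSpace.comap (Z j) inferInstance)
  mono' _ _ hik := completion_mono
    (iSup₂_mono' fun j hj => ⟨j, hj.trans hik, le_rfl⟩)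
  le' _ := completion_le

/-- The filtration `(ℱ_{f k})_k` read along a monotone map `f` of index sets. -/
def reindex [Preorder ι] [Preorder κ] (ℱ : Filtration ι m0) (f : κ → ι) (hf : Monotone f) :
    Filtration κ m0 where
  seq k := ℱ (f k)
  mono' _ _ h := ℱ.mono' (hf h)
  le' k := ℱ.le' (f k)

/-- The extracted filtration `(ℱ_n)_{n ∈ D}`, indexed by `D` itself. -/
def extract [Preorder ι] (ℱ : Filtration ι m0) (D : Set ι) : Filtration D m0 :=
  reindex ℱ (Subtype.val : D → ι) (Subtype.mono_coe D)

end Filtrations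

section Standardness

/-- Conditional independence of the σ-fields `m₁` and `m₂` given the σ-field `m`.
(Mathlib's notion is restricted to standard Borel spaces, where it is equivalent to this one.) -/
def CondIndepGiven {Ω : Type*} {m0 : MeasurableSpace Ω} (μ : Measure Ω)
    (m m₁ m₂ : MeasurableSpace Ω) : Prop :=
  ∀ s t : Set Ω, MeasurableSet[m₁] s → MeasurableSet[m₂] t →
    μ⟦s ∩ t | m⟧ =ᵐ[μ] μ⟦s | m⟧ * μ⟦t | m⟧

/-- `ℱ` is immersed into `𝒢`: `ℱ_n ⊆ 𝒢_n` for every `n`, and `ℱ_n` is independent of `𝒢_k`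
conditionally on `ℱ_k` when `k` is the index that immediately precedes `n`. -/
def IsImmersed {Ω ι : Type*} {m0 : MeasurableSpace Ω} [Preorder ι] (μ : Measure Ω)
    (ℱ 𝒢 : Filtration ι m0) : Prop :=
  (∀ n, ℱ n ≤ 𝒢 n) ∧ ∀ k n, k ⋖ n → CondIndepGiven μ (ℱ k) (ℱ n) (𝒢 k)

/-- `𝒢` is of product type: it is the natural filtration of a process made of independent
random variables. (Real values: every σ-field is essentially separable.) -/
def IsProductType {Ω ι : Type*} {m0 : MeasurableSpace Ω} [Preorder ι] (μ : Measure Ω)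
    (𝒢 : Filtration ι m0) : Prop :=
  ∃ V : ι → Ω → ℝ, (∀ i, Measurable (V i)) ∧ iIndepFun V μ ∧ 𝒢 = naturalFiltration μ V

/-- `L⁰(Ω, m, μ)`: the classes, up to almost sure equality, of real random variables having an
`m`-measurable representative. -/
def L0 {Ω : Type*} (m : MeasurableSpace Ω) {m0 : MeasurableSpace Ω} (μ : Measure Ω) :
    Set (Ω →ₘ[μ] ℝ) :=
  {X | AEStronglyMeasurable[m] X μ}

/-- An isomorphism of filtered probability spaces: a bijection from `L⁰(ℱ_∞)` onto `L⁰(ℱ'_∞)`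
which preserves the laws, commutes with Borel functions of sequences of random variables, and sends
`ℱ` to `ℱ'`, that is to say, for every `i` the images of the elements of `L⁰(ℱ_i)` generate the
complete σ-field `ℱ'_i`. -/
structure FiltrationIso {Ω Ω' ι : Type*} {m0 : MeasurableSpace Ω} {m0' : MeasurableSpace Ω'}
    [Preorder ι] (μ : Measure Ω) (μ' : Measure Ω')
    (ℱ : Filtration ι m0) (ℱ' : Filtration ι m0') where
  toEquiv : L0 (⨆ i, ℱ i) μ ≃ L0 (⨆ i, ℱ' i) μ'
  map_law : ∀ X, μ'.map ((toEquiv X).1 : Ω' → ℝ) = μ.map (X.1 : Ω → ℝ)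
  comm_borel : ∀ (X : ℕ → L0 (⨆ i, ℱ i) μ) (Y : L0 (⨆ i, ℱ i) μ) (f : (ℕ → ℝ) → ℝ),
    Measurable f → (∀ᵐ ω ∂μ, Y.1 ω = f fun k => (X k).1 ω) →
      ∀ᵐ ω ∂μ', (toEquiv Y).1 ω = f fun k => (toEquiv (X k)).1 ω
  generate : ∀ i, completion μ'
    (⨆ X : L0 (⨆ i, ℱ i) μ, ⨆ (_ : X.1 ∈ L0 (ℱ i) μ),
      MeasurableSpace.comap ((toEquiv X).1 : Ω' → ℝ) (borel ℝ)) = ℱ' i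

/-- `ℱ` is standard: it is immersible into a filtration of product type, that is, on some
probability space there are a filtration of product type and a filtration isomorphic to `ℱ` that is
immersed into it. -/
def IsStandard {Ω ι : Type*} {m0 : MeasurableSpace Ω} [Preorder ι] (μ : Measure Ω)
    (ℱ : Filtration ι m0) : Prop :=
  ∃ (Ω' : Type) (m0' : MeasurableSpace Ω') (μ' : Measure Ω') (ℱ' 𝒢' : Filtration ι m0'),
    IsProbabilityMeasure μ' ∧ Nonempty (FiltrationIso μ μ' ℱ ℱ') ∧
      IsImmersed μ' ℱ' 𝒢' ∧ IsProductType μ' 𝒢'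

/-- `ℱ` is at the threshold of standardness: it is not standard, and an extracted filtration
`(ℱ_n)_{n ∈ D}` is standard exactly when infinitely many integers are skipped. -/
def IsAtThreshold {Ω : Type*} {m0 : MeasurableSpace Ω} (μ : Measure Ω)
    (ℱ : Filtration NonposInt m0) : Prop :=
  ¬ IsStandard μ ℱ ∧
    ∀ D : Set NonposInt, D.Infinite → (IsStandard μ (extract ℱ D) ↔ Dᶜ.Infinite)

end Standardness

section Processes

variable {Ω : Type*} {m0 : MeasurableSpace Ω}

/-- The (inhomogeneous) Markov property of a process indexed by `ℤ₋`: the conditional law of `Z_n`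
given the past up to time `n - 1` is its conditional law given `Z_{n-1}`. -/
def IsMarkov {E : NonposInt → Type*} [∀ n, MeasurableSpace (E n)]
    (μ : Measure Ω) (Z : ∀ n, Ω → E n) : Prop :=
  ∀ (n : NonposInt) (B : Set (E n)), MeasurableSet B →
    μ⟦Z n ⁻¹' B | naturalFiltration μ Z n.prev⟧
      =ᵐ[μ] μ⟦Z n ⁻¹' B | MeasurableSpace.comap (Z n.prev) inferInstance⟧

/-- `ℱ` is `(r_n)`-adic: for every `n`, `ℱ_n` is generated by `ℱ_{n-1}` and a random variable
independent of `ℱ_{n-1}` and uniform on a finite set with `r_n` elements. -/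
def IsAdicFiltration (μ : Measure Ω) (ℱ : Filtration NonposInt m0) (r : NonposInt → ℕ) : Prop :=
  ∀ n : NonposInt, 0 < r n ∧ ∃ U : Ω → Fin (r n), Measurable U ∧
    (∀ i, μ (U ⁻¹' {i}) = (r n : ENNReal)⁻¹) ∧
    Indep (MeasurableSpace.comap U inferInstance) (ℱ n.prev) μ ∧
    ℱ n = completion μ (ℱ n.prev ⊔ MeasurableSpace.comap U inferInstance)

end Processes

end BackwardFiltration

open BackwardFiltration

/-!
Take independent pairs of uniform letters, the pair of rank `k` being drawn from an alphabet `A k`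
with `1 / card (A k)` summable, and reveal them in order of decreasing rank, in two stages: at time
`-(2 * k + 1)` one learns the second letter of rank `k` masked by `code k z u`, where `z` is the
pair of rank `k + 1` and `u` the first letter, and at time `-(2 * k)` one learns the whole pair.

If an extraction skips the times `-(2 * k + 1)` for infinitely many `k`, each of those ranks is
revealed in one go, so there the second letter itself can serve as the innovation and no earlier
information is needed: the innovations between two such ranks determine all the letters in between,
and they are independent, hence the extracted filtration is of product type.

If only finitely many of those times are skipped, compare a configuration with a copy driven by the
same innovations after a remote time, but whose earlier past is resampled. Two distinct values
of the pair of rank `k + 1` have codes whose difference takes each value at boundedly many points,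
so two copies with the same masked letter that differ at rank `k + 1` agree at rank `k` with
probability `O(1 / card (A k))`. As these probabilities are summable, the copies stay different with
probability bounded below, whereas standardness forces them to merge.
-/

open Filter Set
open scoped ENNReal NNReal Topology symmDiff

namespace BackwardFiltration

section Resampling

variable {ι : Type*} {E : ι → Type*}

open Classical in
/-- The configuration obtained from `v` by replacing its coordinates in `s` with those of `w`. -/
noncomputable def resample (s : Set ι) (v w : ∀ i, E i) : ∀ i, E i := s.piecewise w v

theorem resample_of_mem {s : Set ι} {i : ι} (hi : i ∈ s) (v w : ∀ i, E i) :
    resample s v w i = w i := by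
  classical exact s.piecewise_eq_of_mem _ _ hi

theorem resample_of_notMem {s : Set ι} {i : ι} (hi : i ∉ s) (v w : ∀ i, E i) :
    resample s v w i = v i := by
  classical exact s.piecewise_eq_of_notMem _ _ hi

variable [∀ i, MeasurableSpace (E i)]

theorem dependsOn_of_measurable_cylinderEvents {X : Type*} [MeasurableSpace X]
    [MeasurableSingletonClass X] {s : Set ι} {f : (∀ i, E i) → X}
    (hf : Measurable[cylinderEvents s] f) : DependsOn f s := by
  have hle : cylinderEvents s ≤ MeasurableSpace.comap (s.domRestrict (π := E)) inferInstance :=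
    iSup₂_le fun i hi => measurable_iff_comap_le.1 <|
      (measurable_pi_apply (⟨i, hi⟩ : s)).comp (comap_measurable s.domRestrict)
  exact dependsOn_iff_factorsThrough.2 (hf.mono hle le_rfl).factorsThrough

theorem measurable_resample (s : Set ι) :
    Measurable fun p : (∀ i, E i) × (∀ i, E i) => resample s p.1 p.2 := by
  refine measurable_pi_iff.2 fun i => ?_
  by_cases h : i ∈ s
  · simp only [resample_of_mem h]; fun_prop
  · simp only [resample_of_notMem h]; fun_prop

theorem measurable_cylinderEvents_resample_left (r s : Set ι) (w : ∀ i, E i) :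
    Measurable[cylinderEvents r, cylinderEvents r] fun v => resample s v w := by
  rw [measurable_cylinderEvents_iff]
  intro i hi
  by_cases h : i ∈ s
  · simp only [resample_of_mem h]; exact measurable_const
  · simp only [resample_of_notMem h]; exact measurable_cylinderEvent_apply hi

variable (ν : ∀ i, Measure (E i)) [∀ i, IsProbabilityMeasure (ν i)]

theorem measurePreserving_resample (s : Set ι) :
    MeasurePreserving (fun p : (∀ i, E i) × (∀ i, E i) => resample s p.1 p.2)
      ((Measure.infinitePi ν).prod (Measure.infinitePi ν)) (Measure.infinitePi ν) := by
  classical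
  refine ⟨measurable_resample s, Measure.eq_infinitePi _ fun I A hA => ?_⟩
  have hpre : (fun p : (∀ i, E i) × (∀ i, E i) => resample s p.1 p.2) ⁻¹' ((I : Set ι).pi A) =
      (((I.filter (· ∉ s) : Finset ι) : Set ι).pi A) ×ˢ
        (((I.filter (· ∈ s) : Finset ι) : Set ι).pi A) := by
    ext ⟨v, w⟩
    simp only [mem_preimage, Set.mem_pi, mem_prod, Finset.mem_coe, Finset.mem_filter, ← forall_and]
    refine forall_congr' fun i => ?_
    by_cases h : i ∈ s <;> simp [h, resample_of_mem, resample_of_notMem]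
  rw [Measure.map_apply (measurable_resample s) (.pi I.countable_toSet fun i _ => hA i), hpre,
    Measure.prod_prod, Measure.infinitePi_pi _ fun i _ => hA i,
    Measure.infinitePi_pi _ fun i _ => hA i, mul_comm, Finset.prod_filter_mul_prod_filter_not]

theorem tendsto_measure_symmDiff_resample {s : ℕ → Set ι} (hs : ∀ i, ∀ᶠ N in atTop, i ∉ s N)
    {S : Set (∀ i, E i)} (hS : MeasurableSet S) :
    Tendsto (fun N => ((Measure.infinitePi ν).prod (Measure.infinitePi ν))
      ((Prod.fst ⁻¹' S) ∆ ((fun p => resample (s N) p.1 p.2) ⁻¹' S))) atTop (𝓝 0) := by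
  set P := Measure.infinitePi ν
  rw [ENNReal.tendsto_nhds_zero]
  intro ε hε
  have hε2 : 0 < ε / 2 := ENNReal.half_pos hε.ne'
  obtain ⟨C, hC, hCS⟩ := exists_measure_symmDiff_lt_of_generateFrom_isSetRing (μ := P)
    isSetRing_measurableCylinders
    ⟨{univ}, countable_singleton _,
      singleton_subset_iff.2 (univ_mem_measurableCylinders E), by simp⟩
    generateFrom_measurableCylinders.symm hS hε2
  have hCm : NullMeasurableSet (C ∆ S) P :=
    ((MeasurableSet.of_mem_measurableCylinders hC).symmDiff hS).nullMeasurableSet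
  obtain ⟨I, A, -, rfl⟩ := (mem_measurableCylinders C).1 hC
  filter_upwards [(Finset.eventually_all I).2 fun i _ => hs i] with N hN
  have hfix (v w : ∀ i, E i) : resample (s N) v w ∈ cylinder I A ↔ v ∈ cylinder I A := by
    have : I.restrict (resample (s N) v w) = I.restrict v :=
      funext fun i => resample_of_notMem (hN i i.2) v w
    rw [mem_cylinder, mem_cylinder, this]
  have hsub : (Prod.fst ⁻¹' S) ∆ ((fun p => resample (s N) p.1 p.2) ⁻¹' S) ⊆
      Prod.fst ⁻¹' (cylinder I A ∆ S) ∪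
        (fun p : (∀ i, E i) × (∀ i, E i) => resample (s N) p.1 p.2) ⁻¹' (cylinder I A ∆ S) := by
    rintro ⟨v, w⟩
    have := hfix v w
    simp only [Set.mem_symmDiff, mem_union, mem_preimage]
    tauto
  calc (P.prod P) _ ≤ P (cylinder I A ∆ S) + P (cylinder I A ∆ S) := by
        refine (measure_mono hsub).trans ((measure_union_le _ _).trans_eq ?_)
        rw [measurePreserving_fst.measure_preimage hCm,
          (measurePreserving_resample ν (s N)).measure_preimage hCm]
    _ ≤ ε / 2 + ε / 2 := add_le_add hCS.le hCS.le
    _ = ε := ENNReal.add_halves ε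

theorem tendsto_measure_apply_ne_apply_resample {s : ℕ → Set ι}
    (hs : ∀ i, ∀ᶠ N in atTop, i ∉ s N) {X : Type*} [Finite X] [MeasurableSpace X]
    [MeasurableSingletonClass X] {f : (∀ i, E i) → X} (hf : Measurable f) :
    Tendsto (fun N => ((Measure.infinitePi ν).prod (Measure.infinitePi ν))
      {p | f p.1 ≠ f (resample (s N) p.1 p.2)}) atTop (𝓝 0) := by
  have := Fintype.ofFinite X
  have hsum := tendsto_finsetSum Finset.univ fun x _ =>
    tendsto_measure_symmDiff_resample ν hs (hf (measurableSet_singleton x))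
  rw [Finset.sum_const_zero] at hsum
  refine tendsto_of_tendsto_of_tendsto_of_le_of_le tendsto_const_nhds hsum
    (fun _ => zero_le) fun N => ?_
  refine (measure_mono fun p hp => ?_).trans (measure_biUnion_finset_le Finset.univ _)
  exact mem_biUnion (Finset.mem_univ (f p.1)) (Or.inl ⟨rfl, fun h => hp h.symm⟩)

end Resampling

/-- One step of a process, seen from the `σ`-field `m`: the old state `A'` and the first stage
`B = g A' A` of the new state `A` are known, and conditionally on `m` the state `A` takes with
probability `c` each of the values which are compatible with `B`. -/
structure IsTwoStage {Ω X' X Y : Type*} [m0 : MeasurableSpace Ω] [MeasurableSpace X']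
    [MeasurableSpace X] [MeasurableSpace Y] (μ : Measure Ω) (m : MeasurableSpace Ω) (A' : Ω → X')
    (A : Ω → X) (B : Ω → Y) (g : X' → X → Y) (c : ℝ≥0) : Prop where
  le : m ≤ m0
  measurable_prev : Measurable[m] A'
  measurable : Measurable[m0] A
  measurable_stage : Measurable[m] B
  stage_ae_eq : ∀ᵐ ω ∂μ, B ω = g (A' ω) (A ω)
  measure_inter : ∀ x S, MeasurableSet[m] S →
    μ (A ⁻¹' {x} ∩ S) = c * μ (S ∩ {ω | g (A' ω) x = B ω})

namespace IsTwoStage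

section General

variable {Ω X' X Y : Type*} {m m0 : MeasurableSpace Ω} [MeasurableSpace X'] [MeasurableSpace X]
  [MeasurableSpace Y] {μ : Measure Ω} [IsProbabilityMeasure μ] {A' : Ω → X'} {A : Ω → X}
  {B : Ω → Y} {g : X' → X → Y} {c : ℝ≥0}

theorem measure_preimage_le (h : IsTwoStage μ m A' A B g c) (x : X) : μ (A ⁻¹' {x}) ≤ c := by
  have := h.measure_inter x univ .univ
  rw [inter_univ] at this
  exact this.trans_le (mul_le_of_le_one_right' prob_le_one)

theorem measure_prod_apply_eq_le [Countable X] [MeasurableSingletonClass X]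
    (h : IsTwoStage μ m A' A B g c) : (μ.prod μ) {p | A p.1 = A p.2} ≤ c := by
  have hA : MeasurableSet {p : Ω × Ω | A p.1 = A p.2} :=
    measurableSet_eq_fun (h.measurable.comp measurable_fst) (h.measurable.comp measurable_snd)
  rw [Measure.prod_apply_symm hA]
  exact (lintegral_mono fun ω => h.measure_preimage_le (A ω)).trans (by simp)

variable [Countable X'] [Finite X] [Countable Y] [MeasurableSingletonClass X']
  [MeasurableSingletonClass Y] {L : ℕ}

/-- On the event in question `A` lies in a set of at most `L` values which is known from `m`. -/
theorem measure_ne_inter_stage_eq_le (h : IsTwoStage μ m A' A B g c)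
    (hL : ∀ x x' y y', x ≠ x' → {z | g x z = y ∧ g x' z = y'}.ncard ≤ L)
    {a' : Ω → X'} {b : Ω → Y} (ha' : Measurable[m] a') (hb : Measurable[m] b) :
    μ {ω | A' ω ≠ a' ω ∧ g (a' ω) (A ω) = b ω} ≤ L * c := by
  have := Fintype.ofFinite X
  let T (z : X) : Set Ω := {ω | A' ω ≠ a' ω ∧ g (a' ω) z = b ω}
  let H (z : X) : Set Ω := {ω | g (A' ω) z = B ω}
  have hT (z : X) : MeasurableSet[m] (T z) :=
    (h.measurable_prev.prodMk (ha'.prodMk hb)) (MeasurableSet.of_discrete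
      (s := {q : X' × X' × Y | q.1 ≠ q.2.1 ∧ g q.2.1 z = q.2.2}))
  have hH (z : X) : MeasurableSet[m] (H z) :=
    (h.measurable_prev.prodMk h.measurable_stage) (MeasurableSet.of_discrete
      (s := {q : X' × Y | g q.1 z = q.2}))
  have hTH (z : X) : MeasurableSet (T z ∩ H z) := h.le _ ((hT z).inter (hH z))
  have hcount (ω : Ω) : ∑ z, (T z ∩ H z).indicator (1 : Ω → ℝ≥0∞) ω ≤ L := by
    classical
    by_cases hne : A' ω = a' ω
    · simp [T, hne]
    · refine le_trans (le_of_eq ?_)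
        (Nat.cast_le.2 (hL (A' ω) (a' ω) (B ω) (b ω) hne))
      rw [ncard_eq_toFinset_card', toFinset_ofPred, Finset.card_filter, Nat.cast_sum]
      refine Finset.sum_congr rfl fun z _ => ?_
      simp [indicator_apply, T, H, hne, and_comm]
  calc μ {ω | A' ω ≠ a' ω ∧ g (a' ω) (A ω) = b ω}
      ≤ μ (⋃ z ∈ (Finset.univ : Finset X), A ⁻¹' {z} ∩ T z) :=
        measure_mono fun ω hω => mem_biUnion (Finset.mem_univ (A ω)) ⟨rfl, hω⟩
    _ ≤ ∑ z, c * μ (T z ∩ H z) := (measure_biUnion_finset_le _ _).trans_eq <|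
        Finset.sum_congr rfl fun z _ => h.measure_inter z _ (hT z)
    _ = c * ∫⁻ ω, ∑ z, (T z ∩ H z).indicator 1 ω ∂μ := by
        rw [lintegral_finsetSum _ fun z _ => measurable_one.indicator (hTH z), Finset.mul_sum]
        simp only [lintegral_indicator_one (hTH _)]
    _ ≤ c * ∫⁻ _, L ∂μ := by gcongr with ω; exact hcount ω
    _ = L * c := by simp [mul_comm]

end General

section Resampling

variable {ι : Type*} {E : ι → Type*} [∀ i, MeasurableSpace (E i)] {ν : ∀ i, Measure (E i)}
  [∀ i, IsProbabilityMeasure (ν i)] {L : ℕ}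

theorem measure_apply_eq_apply_resample_le {X' X Y : Type*} [MeasurableSpace X']
    [MeasurableSpace X] [MeasurableSpace Y] [Countable X'] [Finite X] [Countable Y]
    [MeasurableSingletonClass X'] [MeasurableSingletonClass X] [MeasurableSingletonClass Y]
    {α' : (∀ i, E i) → X'} {α : (∀ i, E i) → X} {β : (∀ i, E i) → Y} {g : X' → X → Y} {c : ℝ≥0}
    {r : Set ι} (h : IsTwoStage (Measure.infinitePi ν) (cylinderEvents r) α' α β g c)
    (hL : ∀ x x' y y', x ≠ x' → {z | g x z = y ∧ g x' z = y'}.ncard ≤ L) (s : Set ι) :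
    ((Measure.infinitePi ν).prod (Measure.infinitePi ν)) {p | α p.1 = α (resample s p.1 p.2)} ≤
      ((Measure.infinitePi ν).prod (Measure.infinitePi ν))
        {p | α' p.1 = α' (resample s p.1 p.2)} + L * c := by
  set P := Measure.infinitePi ν
  have hα' : Measurable α' := h.measurable_prev.mono h.le le_rfl
  have hβ : Measurable β := h.measurable_stage.mono h.le le_rfl
  have hs := measurable_resample (E := E) s
  let D : Set ((∀ i, E i) × (∀ i, E i)) := {p | α' p.1 ≠ α' (resample s p.1 p.2) ∧
    g (α' (resample s p.1 p.2)) (α p.1) = β (resample s p.1 p.2)}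
  have hD : MeasurableSet D :=
    (((hα'.comp measurable_fst).prodMk (h.measurable.comp measurable_fst)).prodMk
      ((hα'.comp hs).prodMk (hβ.comp hs))) (MeasurableSet.of_discrete
        (s := {q : (X' × X) × X' × Y | q.1.1 ≠ q.2.1 ∧ g q.2.1 q.1.2 = q.2.2}))
  have hD_le : (P.prod P) D ≤ L * c := by
    rw [Measure.prod_apply_symm hD]
    refine (lintegral_mono fun w => ?_).trans_eq
      ((lintegral_const (L * c : ℝ≥0∞)).trans (by rw [measure_univ, mul_one]))
    have hw := measurable_cylinderEvents_resample_left r s w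
    exact h.measure_ne_inter_stage_eq_le hL (h.measurable_prev.comp hw)
      (h.measurable_stage.comp hw)
  calc (P.prod P) {p | α p.1 = α (resample s p.1 p.2)}
      ≤ (P.prod P) ({p | α' p.1 = α' (resample s p.1 p.2)} ∪ D) := by
        refine measure_mono_ae ?_
        filter_upwards [(measurePreserving_resample ν s).quasiMeasurePreserving.ae h.stage_ae_eq]
          with p hp heq
        rw [← show α p.1 = _ from heq] at hp
        exact (em _).imp_right fun hne => ⟨hne, hp.symm⟩
    _ ≤ _ := (measure_union_le _ _).trans (add_le_add le_rfl hD_le)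

variable {r : ℕ → Set ι} {X Y : ℕ → Type*} [∀ k, Finite (X k)] [∀ k, Countable (Y k)]
  [∀ k, MeasurableSpace (X k)] [∀ k, MeasurableSpace (Y k)]
  [∀ k, MeasurableSingletonClass (X k)] [∀ k, MeasurableSingletonClass (Y k)]
  {α : ∀ k, (∀ i, E i) → X k} {β : ∀ k, (∀ i, E i) → Y k} {g : ∀ k, X (k + 1) → X k → Y k}
  {c : ℕ → ℝ≥0}

theorem measure_apply_zero_eq_apply_resample_le
    (h : ∀ k, IsTwoStage (Measure.infinitePi ν) (cylinderEvents (r k)) (α (k + 1)) (α k) (β k)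
      (g k) (c k))
    (hL : ∀ k x x' y y', x ≠ x' → {z | g k x z = y ∧ g k x' z = y'}.ncard ≤ L) (N : ℕ) :
    ((Measure.infinitePi ν).prod (Measure.infinitePi ν))
      {p | α 0 p.1 = α 0 (resample (r N) p.1 p.2)} ≤ (L + 1) * ∑' k, (c k : ℝ≥0∞) := by
  set P := Measure.infinitePi ν
  have hiter : ∀ k, (P.prod P) {p | α 0 p.1 = α 0 (resample (r N) p.1 p.2)} ≤
      (P.prod P) {p | α k p.1 = α k (resample (r N) p.1 p.2)} +
        L * ∑ j ∈ Finset.range k, (c j : ℝ≥0∞) := by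
    intro k
    induction k with
    | zero => simp
    | succ k ih =>
      refine ih.trans ((add_le_add_left
        ((h k).measure_apply_eq_apply_resample_le (hL k) (r N)) _).trans_eq ?_)
      rw [Finset.sum_range_succ]
      ring
  have hstart : (P.prod P) {p | α (N + 1) p.1 = α (N + 1) (resample (r N) p.1 p.2)} ≤
      c (N + 1) := by
    have hdep (p : (∀ i, E i) × (∀ i, E i)) : α (N + 1) (resample (r N) p.1 p.2) = α (N + 1) p.2 :=
      dependsOn_of_measurable_cylinderEvents (h N).measurable_prev fun i hi =>
        resample_of_mem hi p.1 p.2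
    simp only [hdep]
    exact (h (N + 1)).measure_prod_apply_eq_le
  calc _ ≤ (c (N + 1) : ℝ≥0∞) + L * ∑ j ∈ Finset.range (N + 1), (c j : ℝ≥0∞) :=
        (hiter (N + 1)).trans (add_le_add hstart le_rfl)
    _ ≤ (∑' k, (c k : ℝ≥0∞)) + L * ∑' k, (c k : ℝ≥0∞) :=
        add_le_add (ENNReal.le_tsum _) (by gcongr; exact ENNReal.sum_le_tsum _)
    _ = _ := by ring

/-- Resampling ever more remote coordinates leaves `α 0` unchanged with probability tending to `1`,
whereas `measure_apply_zero_eq_apply_resample_le` bounds that probability by the right side. -/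
theorem one_le_mul_tsum
    (h : ∀ k, IsTwoStage (Measure.infinitePi ν) (cylinderEvents (r k)) (α (k + 1)) (α k) (β k)
      (g k) (c k))
    (hL : ∀ k x x' y y', x ≠ x' → {z | g k x z = y ∧ g k x' z = y'}.ncard ≤ L)
    (hr : ∀ i, ∀ᶠ N in atTop, i ∉ r N) :
    1 ≤ (L + 1) * ∑' k, (c k : ℝ≥0∞) := by
  set P := Measure.infinitePi ν
  have hone (N : ℕ) : 1 ≤ (L + 1) * ∑' k, (c k : ℝ≥0∞) +
      (P.prod P) {p | α 0 p.1 ≠ α 0 (resample (r N) p.1 p.2)} := by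
    calc 1 = (P.prod P) ({p | α 0 p.1 = α 0 (resample (r N) p.1 p.2)} ∪
          {p | α 0 p.1 ≠ α 0 (resample (r N) p.1 p.2)}) := by
          rw [← measure_univ (μ := P.prod P)]
          exact congrArg _ (union_compl_self _).symm
      _ ≤ _ := (measure_union_le _ _).trans
          (add_le_add (measure_apply_zero_eq_apply_resample_le h hL N) le_rfl)
  simpa using ge_of_tendsto' (tendsto_const_nhds.add
    (tendsto_measure_apply_ne_apply_resample ν hr (h 0).measurable)) hone

end Resampling

end IsTwoStage

section Completion

variable {Ω : Type*} {m m₁ m₂ m0 : MeasurableSpace Ω} {μ : Measure Ω}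

theorem le_completion (h : m ≤ m0) : m ≤ completion μ m := fun s hs =>
  measurableSet_completion_iff.2 ⟨⟨s, hs, EventuallyEq.rfl⟩, h s hs⟩

theorem completion_completion : completion μ (completion μ m) = completion μ m := by
  refine le_antisymm (fun s hs => ?_) (le_completion completion_le)
  obtain ⟨⟨t, ht, hst⟩, hs⟩ := measurableSet_completion_iff.1 hs
  obtain ⟨⟨u, hu, htu⟩, -⟩ := measurableSet_completion_iff.1 ht
  exact measurableSet_completion_iff.2 ⟨⟨u, hu, hst.trans htu⟩, hs⟩

theorem completion_sup (h₁ : m₁ ≤ m0) (h₂ : m₂ ≤ m0) :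
    completion μ (completion μ m₁ ⊔ m₂) = completion μ (m₁ ⊔ m₂) := by
  refine le_antisymm ?_ (completion_mono (sup_le_sup_right (le_completion h₁) _))
  rw [← completion_completion (m := m₁ ⊔ m₂)]
  exact completion_mono (sup_le (completion_mono le_sup_left)
    (le_sup_right.trans (le_completion (sup_le h₁ h₂))))

theorem exists_measurable_ae_eq_of_measurable_completion {X : Type*} [MeasurableSpace X]
    [Countable X] [MeasurableSingletonClass X] {f : Ω → X} (hf : Measurable[completion μ m] f) :
    ∃ f' : Ω → X, Measurable[m] f' ∧ f' =ᵐ[μ] f := by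
  cases isEmpty_or_nonempty X
  · exact ⟨f, @measurable_of_empty_codomain _ _ m _ _ f, .rfl⟩
  choose t ht hft using fun x =>
    (measurableSet_completion_iff.1 (hf (measurableSet_singleton x))).1
  obtain ⟨f', hf'm, hf'⟩ := @exists_measurable_piecewise _ _ m _ _ _ _
    (fun x => t x \ ⋃ y ≠ x, t y) (fun x => (ht x).diff (.biUnion (to_countable _) fun y _ => ht y))
    (fun x _ => x) (fun x => measurable_const) fun x y hxy ω hω =>
      (hω.1.2 (mem_biUnion hxy.symm hω.2.1)).elim
  refine ⟨f', hf'm, ?_⟩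
  filter_upwards [ae_all_iff.2 hft] with ω hω
  have hmem (x : X) : ω ∈ t x ↔ f ω = x := (hω x).symm.to_iff
  exact hf' (f ω) ⟨(hmem _).2 rfl, by simp [hmem]⟩

end Completion

section ConditionalIndependence

variable {Ω : Type*} {m m₁ m₂ m0 : MeasurableSpace Ω} {μ : Measure Ω} [IsProbabilityMeasure μ]
  {s T H : Set Ω} {c : ℝ≥0}

theorem condExp_indicator_ae_eq_of_measure_inter (hm : m ≤ m0) (hs : MeasurableSet s)
    (hH : MeasurableSet[m] H) (h : ∀ S, MeasurableSet[m] S → μ (s ∩ S) = c * μ (S ∩ H)) :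
    μ⟦s | m⟧ =ᵐ[μ] H.indicator fun _ => (c : ℝ) := by
  refine (ae_eq_condExp_of_forall_setIntegral_eq hm ((integrable_const _).indicator hs)
    (fun S _ _ => ((integrable_const _).indicator (hm H hH)).integrableOn) (fun S hS _ => ?_)
    (stronglyMeasurable_const.indicator hH).aestronglyMeasurable).symm
  rw [setIntegral_indicator (hm H hH), setIntegral_indicator hs, setIntegral_const,
    setIntegral_const, inter_comm S s]
  simp [Measure.real, h S hS, mul_comm]

theorem CondIndepGiven.measure_inter (hm : m ≤ m0) (hm₁ : m₁ ≤ m0) (hm₂ : m₂ ≤ m0)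
    (hci : CondIndepGiven μ m m₁ m₂) (hs : MeasurableSet[m₁] s) (hT : MeasurableSet[m₂] T)
    (hH : MeasurableSet[m] H) (h : ∀ S, MeasurableSet[m] S → μ (s ∩ S) = c * μ (S ∩ H)) :
    μ (s ∩ T) = c * μ (T ∩ H) := by
  have hsT : μ⟦s ∩ T | m⟧ =ᵐ[μ] H.indicator fun ω => (c : ℝ) * (μ⟦T | m⟧) ω := by
    filter_upwards [hci s T hs hT,
      condExp_indicator_ae_eq_of_measure_inter hm (hm₁ _ hs) hH h] with ω h₁ h₂
    rw [h₁, Pi.mul_apply, h₂]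
    by_cases hω : ω ∈ H <;> simp [hω]
  have hreal : μ.real (s ∩ T) = c * μ.real (T ∩ H) :=
    calc μ.real (s ∩ T) = ∫ ω, (μ⟦s ∩ T | m⟧) ω ∂μ := by
          rw [integral_condExp hm, integral_indicator_const _ ((hm₁ _ hs).inter (hm₂ _ hT))]
          simp
      _ = c * ∫ ω in H, (μ⟦T | m⟧) ω ∂μ := by
          rw [integral_congr_ae hsT, integral_indicator (hm H hH), integral_const_mul]
      _ = c * μ.real (T ∩ H) := by
          rw [setIntegral_condExp hm ((integrable_const _).indicator (hm₂ _ hT)) hH,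
            setIntegral_indicator (hm₂ _ hT), setIntegral_const, inter_comm H T]
          simp
  rwa [← ENNReal.toReal_eq_toReal_iff' (measure_ne_top _ _)
    (ENNReal.mul_ne_top ENNReal.coe_ne_top (measure_ne_top _ _)), ENNReal.toReal_mul,
    ENNReal.coe_toReal]

end ConditionalIndependence

theorem measurableSet_setOf_apply_eq {Ω X' X Y : Type*} {_ : MeasurableSpace Ω}
    [MeasurableSpace X'] [MeasurableSpace Y] [Countable X'] [Countable Y]
    [MeasurableSingletonClass X'] [MeasurableSingletonClass Y] {a' : Ω → X'} {b : Ω → Y}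
    (ha' : Measurable a') (hb : Measurable b) (g : X' → X → Y) (x : X) :
    MeasurableSet {ω | g (a' ω) x = b ω} :=
  (ha'.prodMk hb) (MeasurableSet.of_discrete (s := {q : X' × Y | g q.1 x = q.2}))

namespace IsTwoStage

variable {Ω X' X Y : Type*} {m m₁ m₂ m0 : MeasurableSpace Ω} [MeasurableSpace X']
  [MeasurableSpace X] [MeasurableSpace Y] {μ : Measure Ω} {A' : Ω → X'} {A : Ω → X}
  {B : Ω → Y} {g : X' → X → Y} {c : ℝ≥0} [Countable X'] [Countable Y]
  [MeasurableSingletonClass X'] [MeasurableSingletonClass Y]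

theorem of_condIndepGiven [MeasurableSingletonClass X] [IsProbabilityMeasure μ]
    (h : IsTwoStage μ m A' A B g c)
    (hci : CondIndepGiven μ m m₁ m₂) (hm₁ : m₁ ≤ m0) (hm₂ : m₂ ≤ m0) (hmm₂ : m ≤ m₂)
    (hA : Measurable[m₁] A) : IsTwoStage μ m₂ A' A B g c where
  le := hm₂
  measurable_prev := h.measurable_prev.mono hmm₂ le_rfl
  measurable := h.measurable
  measurable_stage := h.measurable_stage.mono hmm₂ le_rfl
  stage_ae_eq := h.stage_ae_eq
  measure_inter x _ hS := hci.measure_inter h.le hm₁ hm₂ (hA (measurableSet_singleton x)) hS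
    (measurableSet_setOf_apply_eq h.measurable_prev h.measurable_stage g x) (h.measure_inter x)

theorem map [Countable X] [MeasurableSingletonClass X] (h : IsTwoStage μ m A' A B g c) {R : Type*}
    {n n0 : MeasurableSpace R} (hn : n ≤ n0) {v : Ω → R} (hv : Measurable[m0, n0] v)
    (hvm : Measurable[m, n] v) {α' : R → X'} {α : R → X} {β : R → Y} (hα' : Measurable[n] α')
    (hα : Measurable α) (hβ : Measurable[n] β) (hα'v : α' ∘ v =ᵐ[μ] A') (hαv : α ∘ v =ᵐ[μ] A)
    (hβv : β ∘ v =ᵐ[μ] B) : IsTwoStage (μ.map v) n α' α β g c where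
  le := hn
  measurable_prev := hα'
  measurable := hα
  measurable_stage := hβ
  stage_ae_eq := by
    have hm : MeasurableSet {w | β w = g (α' w) (α w)} :=
      ((hβ.mono hn le_rfl).prodMk ((hα'.mono hn le_rfl).prodMk hα)) (MeasurableSet.of_discrete
        (s := {q : Y × X' × X | q.1 = g q.2.1 q.2.2}))
    refine (ae_map_iff hv.aemeasurable hm).2 ?_
    filter_upwards [h.stage_ae_eq, hα'v, hαv, hβv] with ω h₀ h₁ h₂ h₃
    rw [← h₁, ← h₂, ← h₃] at h₀
    exact h₀
  measure_inter x S hS := by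
    have hH : MeasurableSet[n] {w | g (α' w) x = β w} := measurableSet_setOf_apply_eq hα' hβ g x
    rw [Measure.map_apply hv ((hα (measurableSet_singleton x)).inter (hn _ hS)),
      Measure.map_apply hv (hn _ (hS.inter hH))]
    refine (measure_congr ?_).trans ((h.measure_inter x _ (hvm hS)).trans
      (congrArg _ (measure_congr ?_)))
    · filter_upwards [hαv] with ω hω
      exact propext (and_congr_left' (iff_of_eq (congrArg (· = x) hω)))
    · filter_upwards [hα'v, hβv] with ω h₁ h₂
      exact propext (and_congr_right' (by simp [← h₁, ← h₂]))

end IsTwoStage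

section Decode

variable (X : Type*) [MeasurableSpace X] [StandardBorelSpace X] [Nonempty X]

/-- A measurable left inverse of `embeddingReal X`. -/
noncomputable def decodeReal : ℝ → X :=
  Function.extend (embeddingReal X) id fun _ => Classical.arbitrary X

theorem measurable_decodeReal : Measurable (decodeReal X) :=
  (measurableEmbedding_embeddingReal X).measurable_extend measurable_id measurable_const

theorem leftInverse_decodeReal : Function.LeftInverse (decodeReal X) (embeddingReal X) :=
  (measurableEmbedding_embeddingReal X).injective.extend_apply id _

end Decode

namespace FiltrationIso

theorem measurable_mem_of_measurableSet {Ω : Type*} {m : MeasurableSpace Ω} {S : Set Ω}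
    (hS : MeasurableSet[m] S) : Measurable[m] (· ∈ S) := measurable_mem.2 hS

section Image

variable {Ω Ω' ι : Type*} {m0 : MeasurableSpace Ω} {m0' : MeasurableSpace Ω'} [Preorder ι]
  {μ : Measure Ω} {μ' : Measure Ω'} {ℱ : Filtration ι m0} {ℱ' : Filtration ι m0'}
  {X Y : Type*} [MeasurableSpace X] [MeasurableSpace Y]

theorem measurable_of_iSup {A : Ω → X} (hA : Measurable[⨆ i, ℱ i] A) : Measurable A :=
  hA.mono (iSup_le ℱ.le) le_rfl

variable [StandardBorelSpace X] [StandardBorelSpace Y]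

/-- The class of the real encoding of a random variable. -/
noncomputable def encode (A : Ω → X) (hA : Measurable[⨆ i, ℱ i] A) : L0 (⨆ i, ℱ i) μ :=
  have hm : Measurable[⨆ i, ℱ i] (embeddingReal X ∘ A) :=
    (measurableEmbedding_embeddingReal X).measurable.comp hA
  ⟨AEEqFun.mk (embeddingReal X ∘ A)
    (hm.mono (iSup_le ℱ.le) le_rfl).aestronglyMeasurable,
    (hm.stronglyMeasurable.aestronglyMeasurable).congr (AEEqFun.coeFn_mk _ _).symm⟩

theorem coe_encode_ae_eq (A : Ω → X) (hA : Measurable[⨆ i, ℱ i] A) :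
    (encode (μ := μ) A hA).1 =ᵐ[μ] embeddingReal X ∘ A := AEEqFun.coeFn_mk _ _

theorem encode_mem_L0 {i : ι} {A : Ω → X} (hA : Measurable[ℱ i] A) :
    (encode A (hA.mono (le_iSup ℱ i) le_rfl)).1 ∈ L0 (ℱ i) μ :=
  (((measurableEmbedding_embeddingReal X).measurable.comp hA).stronglyMeasurable
    |>.aestronglyMeasurable).congr (coe_encode_ae_eq A _).symm

variable [Nonempty X] [Nonempty Y] (Ψ : FiltrationIso μ μ' ℱ ℱ')

/-- The action of an isomorphism on a random variable with values in a standard Borel space: the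
variable is encoded as a real one, to which the isomorphism applies, and the result is decoded. -/
noncomputable def image (A : Ω → X) (hA : Measurable[⨆ i, ℱ i] A) : Ω' → X :=
  decodeReal X ∘ (Ψ.toEquiv (encode A hA)).1

theorem measurable_toEquiv (Z : L0 (⨆ i, ℱ i) μ) : Measurable (Ψ.toEquiv Z).1 :=
  (Ψ.toEquiv Z).1.stronglyMeasurable.measurable

theorem measurable_image (A : Ω → X) (hA : Measurable[⨆ i, ℱ i] A) :
    Measurable (Ψ.image A hA) :=
  (measurable_decodeReal X).comp (Ψ.measurable_toEquiv _)

theorem toEquiv_ae_eq_comp {A : Ω → X} (hA : Measurable[⨆ i, ℱ i] A) {f : X → ℝ}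
    (hf : Measurable f) {Z : L0 (⨆ i, ℱ i) μ} (hZ : Z.1 =ᵐ[μ] f ∘ A) :
    (Ψ.toEquiv Z).1 =ᵐ[μ'] f ∘ Ψ.image A hA := by
  refine Ψ.comm_borel (fun _ => encode A hA) Z _
    ((hf.comp (measurable_decodeReal X)).comp (measurable_pi_apply 0)) ?_
  filter_upwards [hZ, coe_encode_ae_eq A hA] with ω h₁ h₂
  simp only [h₁, h₂, Function.comp_apply, leftInverse_decodeReal X (A ω)]

theorem image_comp {A : Ω → X} (hA : Measurable[⨆ i, ℱ i] A) {f : X → Y} (hf : Measurable f) :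
    Ψ.image (f ∘ A) (hf.comp hA) =ᵐ[μ'] f ∘ Ψ.image A hA := by
  filter_upwards [Ψ.toEquiv_ae_eq_comp hA ((measurableEmbedding_embeddingReal Y).measurable.comp hf)
    (coe_encode_ae_eq (f ∘ A) (hf.comp hA))] with ω hω
  simp only [image, Function.comp_apply] at hω ⊢
  rw [hω, leftInverse_decodeReal Y]

theorem image_prodMk {A : Ω → X} {B : Ω → Y} (hA : Measurable[⨆ i, ℱ i] A)
    (hB : Measurable[⨆ i, ℱ i] B) : Ψ.image (fun ω => (A ω, B ω)) (hA.prodMk hB) =ᵐ[μ']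
      fun ω => (Ψ.image A hA ω, Ψ.image B hB ω) := by
  filter_upwards [Ψ.image_comp (hA.prodMk hB) measurable_fst,
    Ψ.image_comp (hA.prodMk hB) measurable_snd] with ω h₁ h₂
  exact Prod.ext h₁.symm h₂.symm

theorem map_image (A : Ω → X) (hA : Measurable[⨆ i, ℱ i] A) :
    μ'.map (Ψ.image A hA) = μ.map A := by
  rw [image, ← Measure.map_map (measurable_decodeReal X) (Ψ.measurable_toEquiv _), Ψ.map_law,
    Measure.map_congr (coe_encode_ae_eq A hA), Measure.map_map (measurable_decodeReal X)
      ((measurableEmbedding_embeddingReal X).measurable.comp (measurable_of_iSup hA)),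
    ← Function.comp_assoc, (leftInverse_decodeReal X).comp_eq_id, Function.id_comp]

theorem measure_image_preimage {A : Ω → X} (hA : Measurable[⨆ i, ℱ i] A) {T : Set X}
    (hT : MeasurableSet T) : μ' (Ψ.image A hA ⁻¹' T) = μ (A ⁻¹' T) := by
  rw [← Measure.map_apply (Ψ.measurable_image A hA) hT, Ψ.map_image,
    Measure.map_apply (measurable_of_iSup hA) hT]

theorem ae_image {A : Ω → X} (hA : Measurable[⨆ i, ℱ i] A) {p : X → Prop}
    (hp : MeasurableSet {x | p x}) (h : ∀ᵐ ω ∂μ, p (A ω)) : ∀ᵐ ω ∂μ', p (Ψ.image A hA ω) := by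
  rw [← ae_map_iff (Ψ.measurable_image A hA).aemeasurable hp, Ψ.map_image]
  exact (ae_map_iff (measurable_of_iSup hA).aemeasurable hp).2 h

theorem measurable_image_of_measurable {i : ι} {A : Ω → X} (hA : Measurable[ℱ i] A) :
    Measurable[ℱ' i] (Ψ.image A (hA.mono (le_iSup ℱ i) le_rfl)) := by
  have hle : ⨆ Z : L0 (⨆ i, ℱ i) μ, ⨆ (_ : Z.1 ∈ L0 (ℱ i) μ),
      MeasurableSpace.comap ((Ψ.toEquiv Z).1 : Ω' → ℝ) (borel ℝ) ≤ m0' := by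
    simp only [← BorelSpace.measurable_eq (α := ℝ)]
    exact iSup₂_le fun Z _ => (Ψ.measurable_toEquiv Z).comap_le
  refine (measurable_decodeReal X).comp (measurable_iff_comap_le.2 ?_)
  rw [← Ψ.generate i, BorelSpace.measurable_eq (α := ℝ)]
  exact (le_iSup₂ (f := fun (Z : L0 (⨆ i, ℱ i) μ) (_ : Z.1 ∈ L0 (ℱ i) μ) =>
    MeasurableSpace.comap ((Ψ.toEquiv Z).1 : Ω' → ℝ) (borel ℝ)) _ (encode_mem_L0 hA)).trans
      (le_completion hle)

/-- The action of an isomorphism on an event of `ℱ_∞`. -/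
def imageSet (S : Set Ω) (hS : MeasurableSet[⨆ i, ℱ i] S) : Set Ω' :=
  {ω | Ψ.image (· ∈ S) (measurable_mem_of_measurableSet hS) ω}

theorem imageSet_of_eq_preimage {S : Set Ω} (hS : MeasurableSet[⨆ i, ℱ i] S) {A : Ω → X}
    (hA : Measurable[⨆ i, ℱ i] A) {T : Set X} (hT : MeasurableSet T) (h : S = A ⁻¹' T) :
    Ψ.imageSet S hS =ᵐ[μ'] Ψ.image A hA ⁻¹' T := by
  subst h
  exact Ψ.image_comp hA (measurable_mem.2 hT)

theorem imageSet_compl {S : Set Ω} (hS : MeasurableSet[⨆ i, ℱ i] S) :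
    Ψ.imageSet Sᶜ (MeasurableSpace.measurableSet_compl _ S hS) =ᵐ[μ'] (Ψ.imageSet S hS)ᶜ :=
  Ψ.image_comp (measurable_mem_of_measurableSet hS) (measurable_from_top (f := Not))

theorem imageSet_iUnion {S : ℕ → Set Ω} (hS : ∀ n, MeasurableSet[⨆ i, ℱ i] (S n)) :
    Ψ.imageSet (⋃ n, S n) (MeasurableSpace.measurableSet_iUnion _ S hS) =ᵐ[μ']
      ⋃ n, Ψ.imageSet (S n) (hS n) := by
  have hm : Measurable[⨆ i, ℱ i] fun ω n => ω ∈ S n :=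
    @measurable_pi_lambda _ _ _ (⨆ i, ℱ i) _ _ fun n => measurable_mem_of_measurableSet (hS n)
  have hT (n : ℕ) : MeasurableSet {P : ℕ → Prop | P n} := measurable_mem.1 (measurable_pi_apply n)
  have h := Ψ.imageSet_of_eq_preimage (MeasurableSpace.measurableSet_iUnion _ S hS) hm
    (.iUnion hT) (by rw [preimage_iUnion]; rfl)
  rw [preimage_iUnion] at h
  exact h.trans (Filter.EventuallyEq.countable_iUnion
    fun n => (Ψ.imageSet_of_eq_preimage (hS n) hm (hT n) rfl).symm)

theorem exists_ae_eq_imageSet {i : ι} {S' : Set Ω'} (hS' : MeasurableSet[ℱ' i] S') :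
    ∃ (S : Set Ω) (hS : MeasurableSet[ℱ i] S),
      S' =ᵐ[μ'] Ψ.imageSet S (le_iSup ℱ i S hS) := by
  let m : MeasurableSpace Ω' :=
    { MeasurableSet' := fun S' => ∃ (S : Set Ω) (hS : MeasurableSet[ℱ i] S),
        S' =ᵐ[μ'] Ψ.imageSet S (le_iSup ℱ i S hS)
      measurableSet_empty :=
        have hA : Measurable[⨆ i, ℱ i] fun _ : Ω => (0 : ℝ) := measurable_const
        ⟨∅, MeasurableSpace.measurableSet_empty _, (Ψ.imageSet_of_eq_preimage _ hA .empty rfl).symm⟩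
      measurableSet_compl := fun S' ⟨S, hS, h⟩ =>
        ⟨Sᶜ, MeasurableSpace.measurableSet_compl _ S hS, h.compl.trans (Ψ.imageSet_compl _).symm⟩
      measurableSet_iUnion := fun S' h => by
        choose S hS h using h
        exact ⟨⋃ n, S n, MeasurableSpace.measurableSet_iUnion _ S hS,
          (Filter.EventuallyEq.countable_iUnion h).trans
            (Ψ.imageSet_iUnion fun n => le_iSup ℱ i _ (hS n)).symm⟩ }
  have hle : ⨆ Z : L0 (⨆ i, ℱ i) μ, ⨆ (_ : Z.1 ∈ L0 (ℱ i) μ),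
      MeasurableSpace.comap ((Ψ.toEquiv Z).1 : Ω' → ℝ) (borel ℝ) ≤ m := by
    refine iSup₂_le fun Z hZ => ?_
    rintro _ ⟨T, hT, rfl⟩
    obtain ⟨A, hA, hZA⟩ := hZ
    have hA' : Measurable[⨆ i, ℱ i] A := hA.measurable.mono (le_iSup ℱ i) le_rfl
    refine ⟨A ⁻¹' T, hA.measurable hT, .trans ?_ (Ψ.imageSet_of_eq_preimage _ hA' hT rfl).symm⟩
    exact (Ψ.toEquiv_ae_eq_comp hA' measurable_id hZA).preimage T
  rw [← Ψ.generate i] at hS'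
  obtain ⟨⟨T', hT', hST'⟩, -⟩ := measurableSet_completion_iff.1 hS'
  obtain ⟨S, hS, hTS⟩ := hle T' hT'
  exact ⟨S, hS, hST'.trans hTS⟩

theorem measure_image_preimage_inter_imageSet {A : Ω → X} (hA : Measurable[⨆ i, ℱ i] A)
    {T : Set X} (hT : MeasurableSet T) {S : Set Ω} (hS : MeasurableSet[⨆ i, ℱ i] S) :
    μ' (Ψ.image A hA ⁻¹' T ∩ Ψ.imageSet S hS) = μ (A ⁻¹' T ∩ S) := by
  have hmem := measurable_mem_of_measurableSet hS
  have h := Ψ.measure_image_preimage (hA.prodMk hmem)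
    (hT.prod (MeasurableSet.of_discrete (s := {P : Prop | P})))
  refine (measure_congr ?_).trans h
  filter_upwards [Ψ.image_prodMk hA hmem] with ω hω
  exact propext (iff_of_eq (congrArg (· ∈ T ×ˢ {P : Prop | P}) hω.symm))

end Image

end FiltrationIso

theorem IsTwoStage.image {Ω Ω' ι X' X Y : Type*} {m0 : MeasurableSpace Ω}
    {m0' : MeasurableSpace Ω'} [Preorder ι] {μ : Measure Ω} {μ' : Measure Ω'} {ℱ : Filtration ι m0}
    {ℱ' : Filtration ι m0'} [MeasurableSpace X'] [MeasurableSpace X] [MeasurableSpace Y]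
    [Countable X'] [Countable X] [Countable Y] [MeasurableSingletonClass X']
    [MeasurableSingletonClass X] [MeasurableSingletonClass Y] [Nonempty X'] [Nonempty X]
    [Nonempty Y] {i : ι} {A' : Ω → X'} {A : Ω → X} {B : Ω → Y} {g : X' → X → Y} {c : ℝ≥0}
    (h : IsTwoStage μ (ℱ i) A' A B g c) (Ψ : FiltrationIso μ μ' ℱ ℱ')
    (hA : Measurable[⨆ i, ℱ i] A) :
    IsTwoStage μ' (ℱ' i) (Ψ.image A' (h.measurable_prev.mono (le_iSup ℱ i) le_rfl))
      (Ψ.image A hA) (Ψ.image B (h.measurable_stage.mono (le_iSup ℱ i) le_rfl)) g c := by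
  have hA' := h.measurable_prev.mono (le_iSup ℱ i) le_rfl
  have hB := h.measurable_stage.mono (le_iSup ℱ i) le_rfl
  have hW := hA'.prodMk (hA.prodMk hB)
  have hW_ae : Ψ.image (fun ω => (A' ω, A ω, B ω)) hW =ᵐ[μ']
      fun ω => (Ψ.image A' hA' ω, Ψ.image A hA ω, Ψ.image B hB ω) := by
    filter_upwards [Ψ.image_prodMk hA' (hA.prodMk hB), Ψ.image_prodMk hA hB] with ω h₁ h₂
    rw [h₁, h₂]
  refine ⟨ℱ'.le i, Ψ.measurable_image_of_measurable h.measurable_prev, Ψ.measurable_image A hA,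
    Ψ.measurable_image_of_measurable h.measurable_stage, ?_, fun x S' hS' => ?_⟩
  · filter_upwards [hW_ae, Ψ.ae_image hW (p := fun q => q.2.2 = g q.1 q.2.1) .of_discrete
      h.stage_ae_eq] with ω h₁ h₂
    rwa [h₁] at h₂
  · obtain ⟨S, hS, hSS'⟩ := Ψ.exists_ae_eq_imageSet hS'
    have hmeas (T : Set (X' × X × Y)) : μ' ({ω | (Ψ.image A' hA' ω, Ψ.image A hA ω,
        Ψ.image B hB ω) ∈ T} ∩ S') = μ ({ω | (A' ω, A ω, B ω) ∈ T} ∩ S) := by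
      refine (measure_congr (.inter ?_ hSS')).trans
        (Ψ.measure_image_preimage_inter_imageSet hW (T := T) .of_discrete (le_iSup ℱ i _ hS))
      exact hW_ae.symm.preimage T
    rw [inter_comm S']
    exact (hmeas {q | q.2.1 = x}).trans ((h.measure_inter x S hS).trans
      (by rw [inter_comm S]; exact congrArg _ (hmeas {q | g q.1 x = q.2.2}).symm))

section Coordinates

variable {Ω ι : Type*} {E : ι → Type*} [∀ i, MeasurableSpace (E i)]

theorem comap_cylinderEvents (V : ∀ i, Ω → E i) (s : Set ι) :
    MeasurableSpace.comap (fun ω i => V i ω) (cylinderEvents s) =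
      ⨆ i ∈ s, MeasurableSpace.comap (V i) inferInstance := by
  simp only [cylinderEvents, MeasurableSpace.comap_iSup, MeasurableSpace.comap_comp]
  rfl

variable [Preorder ι] {m0 : MeasurableSpace Ω} {μ : Measure Ω}

theorem measurable_naturalFiltration_cylinderEvents {V : ∀ i, Ω → E i} (hV : ∀ i, Measurable (V i))
    (i : ι) : Measurable[naturalFiltration μ V i, cylinderEvents (Iic i)] fun ω i => V i ω :=
  measurable_iff_comap_le.2 ((comap_cylinderEvents V (Iic i)).le.trans
    (le_completion (iSup₂_le fun j _ => (hV j).comap_le)))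

theorem exists_measurable_cylinderEvents_comp_ae_eq (V : ∀ i, Ω → E i) {X : Type*}
    [MeasurableSpace X] [Countable X] [MeasurableSingletonClass X] [Nonempty X] {i : ι} {A : Ω → X}
    (hA : Measurable[naturalFiltration μ V i] A) :
    ∃ α : (∀ i, E i) → X, Measurable[cylinderEvents (Iic i)] α ∧
      (α ∘ fun ω i => V i ω) =ᵐ[μ] A := by
  obtain ⟨A', hA'm, hA'⟩ := exists_measurable_ae_eq_of_measurable_completion hA
  have hle : (⨆ j, ⨆ (_ : j ≤ i), MeasurableSpace.comap (V j) inferInstance) =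
      MeasurableSpace.comap (fun ω i => V i ω) (cylinderEvents (Iic i)) :=
    (comap_cylinderEvents V (Iic i)).symm
  rw [hle] at hA'm
  obtain ⟨α, hα, rfl⟩ :=
    @Measurable.exists_eq_measurable_comp _ _ _ (cylinderEvents (Iic i)) _ _ _ _ _ hA'm
  exact ⟨α, hα, hA'⟩

end Coordinates

section NotStandard

variable {Ω ι : Type*} [Preorder ι] {m0 : MeasurableSpace Ω} {μ : Measure Ω}
  [IsProbabilityMeasure μ] {ℱ : Filtration ι m0} {t s : ℕ → ι}
  {X Y : ℕ → Type*} [∀ k, Finite (X k)] [∀ k, Countable (Y k)] [∀ k, MeasurableSpace (X k)]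
  [∀ k, MeasurableSpace (Y k)] [∀ k, MeasurableSingletonClass (X k)]
  [∀ k, MeasurableSingletonClass (Y k)] {A : ∀ k, Ω → X k} {B : ∀ k, Ω → Y k}
  {g : ∀ k, X (k + 1) → X k → Y k} {c : ℕ → ℝ≥0} {L : ℕ}

theorem IsStandard.one_le_mul_tsum (hst : IsStandard μ ℱ) (hts : ∀ k, t k ⋖ s k)
    (hle : ∀ k, s (k + 1) ≤ t k) (hcof : ∀ i, ∀ᶠ N in atTop, ¬ i ≤ t N)
    (h : ∀ k, IsTwoStage μ (ℱ (t k)) (A (k + 1)) (A k) (B k) (g k) (c k))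
    (hA : ∀ k, Measurable[ℱ (s k)] (A k))
    (hL : ∀ k x x' y y', x ≠ x' → {z | g k x z = y ∧ g k x' z = y'}.ncard ≤ L) :
    1 ≤ (L + 1) * ∑' k, (c k : ℝ≥0∞) := by
  obtain ⟨Ω', m0', μ', ℱ', 𝒢', _, ⟨Ψ⟩, ⟨h𝒢, hci⟩, V, hV, hVi, rfl⟩ := hst
  have : Nonempty Ω := nonempty_of_isProbabilityMeasure μ
  have (k : ℕ) : Nonempty (X k) := ⟨A k (Classical.arbitrary Ω)⟩
  have (k : ℕ) : Nonempty (Y k) := ⟨B k (Classical.arbitrary Ω)⟩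
  have (i : ι) : IsProbabilityMeasure (μ'.map (V i)) :=
    Measure.isProbabilityMeasure_map (hV i).aemeasurable
  have hA_sup (k : ℕ) : Measurable[⨆ i, ℱ i] (A k) := (hA k).mono (le_iSup ℱ _) le_rfl
  have hAim (k : ℕ) : Measurable[ℱ' (s k)] (Ψ.image (A k) (hA_sup k)) :=
    Ψ.measurable_image_of_measurable (hA k)
  have h' (k : ℕ) := ((h k).image Ψ (hA_sup k)).of_condIndepGiven (hci _ _ (hts k)) (ℱ'.le _)
    ((naturalFiltration μ' V).le _) (h𝒢 _) (hAim k)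
  choose α hα hαA using fun k =>
    exists_measurable_cylinderEvents_comp_ae_eq V ((hAim k).mono (h𝒢 _) le_rfl)
  choose β hβ hβB using fun k =>
    exists_measurable_cylinderEvents_comp_ae_eq V (h' k).measurable_stage
  refine IsTwoStage.one_le_mul_tsum (ν := fun i => μ'.map (V i)) (r := fun k => Iic (t k))
    (α := α) (β := β) (g := g) (fun k => ?_) hL hcof
  rw [← hVi.map_fun_eq_infinitePi_map hV]
  exact (h' k).map cylinderEvents_le_pi (measurable_pi_lambda _ hV)
    (measurable_naturalFiltration_cylinderEvents hV _)
    ((hα (k + 1)).mono (cylinderEvents_mono (Iic_subset_Iic.2 (hle k))) le_rfl)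
    ((hα k).mono cylinderEvents_le_pi le_rfl) (hβ k) (hαA (k + 1)) (hαA k) (hβB k)

theorem not_isStandard_of_isTwoStage (hts : ∀ k, t k ⋖ s k)
    (hle : ∀ k, s (k + 1) ≤ t k) (hcof : ∀ i, ∀ᶠ N in atTop, ¬ i ≤ t N)
    (h : ∀ k, IsTwoStage μ (ℱ (t k)) (A (k + 1)) (A k) (B k) (g k) (c k))
    (hA : ∀ k, Measurable[ℱ (s k)] (A k))
    (hL : ∀ k x x' y y', x ≠ x' → {z | g k x z = y ∧ g k x' z = y'}.ncard ≤ L)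
    (hc : Summable c) : ¬ IsStandard μ ℱ := by
  intro hst
  have htail : Tendsto (fun N => (L + 1) * ∑' k, (c (k + N) : ℝ≥0∞)) atTop (𝓝 0) := by
    simpa using ENNReal.Tendsto.const_mul (ENNReal.tendsto_sum_nat_add (fun k => (c k : ℝ≥0∞))
      (ENNReal.tsum_coe_ne_top_iff_summable.2 hc)) (.inr (by finiteness))
  obtain ⟨N, hN⟩ := (htail.eventually_lt_const zero_lt_one).exists
  refine hN.not_ge ?_
  simp only [add_comm _ N]
  exact hst.one_le_mul_tsum (fun k => hts (N + k)) (fun k => hle (N + k))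
    (fun i => (tendsto_add_atTop_nat N |>.congr (add_comm · N)).eventually (hcof i))
    (fun k => h (N + k)) (fun k => hA (N + k)) fun k => hL (N + k)

end NotStandard

section Code

open Polynomial

theorem ncard_setOf_mul_eval_eq_le {R : Type*} [CommRing R] [IsDomain R] {d : ℕ} {p : R[X]}
    (hp : p ∈ degreeLT R d) (hp₀ : p ≠ 0) (c : R) : {z | z * p.eval z = c}.ncard ≤ d := by
  classical
  have hd : p.natDegree < d := (natDegree_lt_iff_degree_lt hp₀).2 (mem_degreeLT.1 hp)
  have hdeg : 0 < (X * p).natDegree := by rw [natDegree_X_mul hp₀]; exact Nat.succ_pos _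
  have hq : X * p - C c ≠ 0 := sub_ne_zero.2 fun h => by
    rw [h, natDegree_C] at hdeg
    exact hdeg.false
  have hroots : {z | z * p.eval z = c} ⊆ ((X * p - C c).roots.toFinset : Set R) := fun z hz => by
    simpa [hq, sub_eq_zero] using hz
  calc {z | z * p.eval z = c}.ncard
    _ ≤ (X * p - C c).roots.toFinset.card := Set.ncard_coe_finset _ ▸ Set.ncard_le_ncard hroots
    _ ≤ (X * p - C c).roots.card := Multiset.toFinset_card_le _
    _ ≤ (X * p - C c).natDegree := card_roots' _
    _ = p.natDegree + 1 := by rw [natDegree_sub_C, natDegree_X_mul hp₀]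
    _ ≤ d := hd

theorem exists_forall_ncard_setOf_sub_eq_le {F X : Type*} [Field F] [Finite F] [Finite X] {d : ℕ}
    (h : Nat.card X ≤ Nat.card F ^ d) :
    ∃ ψ : X → F → F, ∀ x x' c, x ≠ x' → {z | ψ x z - ψ x' z = c}.ncard ≤ d := by
  have hcard : Nat.card X ≤ Nat.card (degreeLT F d) := by
    rwa [Nat.card_congr (degreeLTEquiv F d).toEquiv, Nat.card_fun, Nat.card_fin]
  have : Finite (degreeLT F d) := .of_equiv _ (degreeLTEquiv F d).symm.toEquiv
  have := Fintype.ofFinite X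
  have := Fintype.ofFinite (degreeLT F d)
  rw [Nat.card_eq_fintype_card, Nat.card_eq_fintype_card] at hcard
  obtain ⟨e⟩ := Function.Embedding.nonempty_of_card_le hcard
  refine ⟨fun x z => z * (e x).1.eval z, fun x x' c hx => ?_⟩
  have hne : (e x - e x').1 ≠ 0 := fun h0 => hx (e.injective (sub_eq_zero.1 (Subtype.ext h0)))
  simpa [← mul_sub] using ncard_setOf_mul_eval_eq_le (e x - e x').2 hne c

/-- The alphabet of rank `k`: the field with `2 ^ (k + 1)` elements. -/
def Alphabet (k : ℕ) : Type := GaloisField 2 (k + 1)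

noncomputable instance (k : ℕ) : Field (Alphabet k) := inferInstanceAs (Field (GaloisField 2 _))

instance (k : ℕ) : Finite (Alphabet k) := inferInstanceAs (Finite (GaloisField 2 _))

instance (k : ℕ) : MeasurableSpace (Alphabet k) := ⊤

instance (k : ℕ) : DiscreteMeasurableSpace (Alphabet k) := ⟨fun _ => trivial⟩

theorem card_alphabet (k : ℕ) : Nat.card (Alphabet k) = 2 ^ (k + 1) :=
  GaloisField.card 2 (k + 1) k.succ_ne_zero

theorem card_alphabet_prod_le (k : ℕ) :
    Nat.card (Alphabet (k + 1) × Alphabet (k + 1)) ≤ Nat.card (Alphabet k) ^ 4 := by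
  rw [Nat.card_prod, card_alphabet, card_alphabet, ← pow_add, ← pow_mul]
  exact Nat.pow_le_pow_right two_pos (by lia)

theorem summable_inv_card_alphabet : Summable fun k => (Nat.card (Alphabet k) : ℝ≥0)⁻¹ := by
  have hcard (k : ℕ) : (Nat.card (Alphabet k) : ℝ≥0)⁻¹ = 2⁻¹ * 2⁻¹ ^ k := by
    rw [card_alphabet, Nat.cast_pow, Nat.cast_ofNat, ← inv_pow, pow_succ']
  rw [funext hcard]
  exact (NNReal.summable_geometric (inv_lt_one_of_one_lt₀ one_lt_two)).mul_left _

/-- The code of rank `k`: a function of a letter of rank `k` for each pair of letters of rank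
`k + 1`, any two of these functions being equal up to a given constant at `4` letters at most. -/
noncomputable def code (k : ℕ) : Alphabet (k + 1) × Alphabet (k + 1) → Alphabet k → Alphabet k :=
  (exists_forall_ncard_setOf_sub_eq_le (card_alphabet_prod_le k)).choose

theorem ncard_setOf_code_sub_eq_le (k : ℕ) {x x' : Alphabet (k + 1) × Alphabet (k + 1)}
    (c : Alphabet k) (h : x ≠ x') : {z | code k x z - code k x' z = c}.ncard ≤ 4 :=
  (exists_forall_ncard_setOf_sub_eq_le (card_alphabet_prod_le k)).choose_spec x x' c h

theorem ncard_setOf_sub_code_eq_le (k : ℕ) {x x' : Alphabet (k + 1) × Alphabet (k + 1)}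
    (y y' : Alphabet k) (h : x ≠ x') :
    {z : Alphabet k × Alphabet k | z.2 - code k x z.1 = y ∧ z.2 - code k x' z.1 = y'}.ncard
      ≤ 4 := by
  refine le_trans (Set.ncard_le_ncard_of_injOn Prod.fst ?_ ?_)
    (ncard_setOf_code_sub_eq_le k (y' - y) h)
  · rintro z ⟨rfl, rfl⟩
    simp
  · rintro z ⟨hz, -⟩ z' ⟨hz', -⟩ he
    refine Prod.ext he ?_
    rw [eq_add_of_sub_eq hz, eq_add_of_sub_eq hz', he]

end Code

section Independence

variable {Ω : Type*} {m m0 : MeasurableSpace Ω} {μ : Measure Ω}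

theorem iIndep_of_indep_of_lt {ι α : Type*} [LinearOrder α] [IsProbabilityMeasure μ]
    {m 𝓗 : ι → MeasurableSpace Ω} {ρ : ι → α} (hρ : Function.Injective ρ)
    (h : ∀ i, Indep (m i) (𝓗 i) μ) (hm : ∀ i j, ρ i < ρ j → m j ≤ 𝓗 i) : iIndep m μ := by
  classical
  rw [iIndep_iff]
  intro s
  induction s using Finset.induction_on_min_value ρ with
  | empty => simp
  | insert i s his hmin ih =>
    intro f hf
    rw [Finset.set_biInter_insert, Finset.prod_insert his,
      ← ih fun j hj => hf j (Finset.mem_insert_of_mem hj)]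
    refine (Indep_iff _ _ _).1 (h i) _ _ (hf i (Finset.mem_insert_self _ _)) ?_
    refine MeasurableSet.biInter (m := 𝓗 i) s.countable_toSet fun j hj => ?_
    refine hm i j ((hmin j hj).lt_of_ne fun he => his ?_) _ (hf j (Finset.mem_insert_of_mem hj))
    rwa [hρ he]

theorem tsum_measure_preimage_singleton_inter {E : Type*} [MeasurableSpace E] [Countable E]
    [MeasurableSingletonClass E] {f : Ω → E} (hf : Measurable f) (C : Set E) (A : Set Ω) :
    ∑' e : C, μ (f ⁻¹' {(e : E)} ∩ A) = μ (f ⁻¹' C ∩ A) := by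
  have h := tsum_measure_preimage_singleton (μ := μ.restrict A) C.to_countable
    fun e _ => hf (measurableSet_singleton e)
  rw [Measure.restrict_apply (hf C.to_countable.measurableSet)] at h
  rw [← h]
  exact tsum_congr fun e => (Measure.restrict_apply (hf (measurableSet_singleton _))).symm

/-- Conditionally on the σ-field `m`, the law of `W` is uniform on the finite set `E`. -/
def IsUniformGiven {E : Type*} (μ : Measure Ω) (m : MeasurableSpace Ω) (W : Ω → E) : Prop :=
  ∀ e s, MeasurableSet[m] s → μ (W ⁻¹' {e} ∩ s) = (Nat.card E : ℝ≥0∞)⁻¹ * μ s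

namespace IsUniformGiven

variable {E : Type*} {W : Ω → E}

theorem measure_preimage_singleton [IsProbabilityMeasure μ] (h : IsUniformGiven μ m W) (e : E) :
    μ (W ⁻¹' {e}) = (Nat.card E : ℝ≥0∞)⁻¹ := by
  simpa using h e univ .univ

variable [Finite E] [MeasurableSpace E] [DiscreteMeasurableSpace E]

theorem indep [IsProbabilityMeasure μ] (h : IsUniformGiven μ m W) (hW : Measurable W) :
    Indep (MeasurableSpace.comap W inferInstance) m μ := by
  rw [Indep_iff]
  rintro _ s ⟨C, -, rfl⟩ hs
  have key (t) (ht : MeasurableSet[m] t) :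
      μ (W ⁻¹' C ∩ t) = (∑' _ : C, (Nat.card E : ℝ≥0∞)⁻¹) * μ t := by
    rw [← tsum_measure_preimage_singleton_inter hW, ← ENNReal.tsum_mul_right]
    exact tsum_congr fun e => h e t ht
  rw [key s hs, ← inter_univ (W ⁻¹' C), key univ .univ, measure_univ, mul_one]

theorem sub [AddGroup E] (h : IsUniformGiven μ m W) (hm : m ≤ m0) {H : Ω → E}
    (hH : Measurable[m] H) : IsUniformGiven μ m fun ω => W ω - H ω := by
  intro e s hs
  have hfiber (d : E) : H ⁻¹' {d} ∩ ((fun ω => W ω - H ω) ⁻¹' {e} ∩ s) =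
      W ⁻¹' {e + d} ∩ (H ⁻¹' {d} ∩ s) := by
    ext ω
    simp only [mem_inter_iff, mem_preimage, mem_singleton_iff, sub_eq_iff_eq_add]
    constructor
    · rintro ⟨rfl, h, hs⟩
      exact ⟨h, rfl, hs⟩
    · rintro ⟨h, rfl, hs⟩
      exact ⟨rfl, h, hs⟩
  have hsum (A : Set Ω) : μ A = ∑' d : (univ : Set E), μ (H ⁻¹' {(d : E)} ∩ A) := by
    rw [tsum_measure_preimage_singleton_inter (hH.mono hm le_rfl), preimage_univ, univ_inter]
  rw [hsum, hsum s, ← ENNReal.tsum_mul_left]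
  exact tsum_congr fun d => by
    rw [hfiber]
    exact h _ _ ((hH (measurableSet_singleton _)).inter hs)

end IsUniformGiven

theorem indep_cylinderEvents_infinitePi {ι : Type*} {E : ι → Type*} [∀ i, MeasurableSpace (E i)]
    (P : ∀ i, Measure (E i)) [∀ i, IsProbabilityMeasure (P i)] {s t : Set ι} (h : Disjoint s t) :
    Indep (cylinderEvents s) (cylinderEvents t) (Measure.infinitePi P) :=
  indep_iSup_of_disjoint (fun i => (measurable_pi_apply i).comap_le)
    (iIndepFun_infinitePi (X := fun _ x => x) fun _ => measurable_id).iIndep h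

theorem isUniformGiven_infinitePi {ι : Type*} {E : ι → Type*} [∀ i, Finite (E i)]
    [∀ i, Nonempty (E i)] [∀ i, MeasurableSpace (E i)] [∀ i, DiscreteMeasurableSpace (E i)]
    {i : ι} {s : Set ι} (hi : i ∉ s) :
    IsUniformGiven (Measure.infinitePi fun i => uniformOn (univ : Set (E i)))
      (cylinderEvents s) (fun ω : ∀ i, E i => ω i) := by
  have := Fintype.ofFinite (E i)
  intro e t ht
  rw [(Indep_iff _ _ _).1 (indep_cylinderEvents_infinitePi _ (disjoint_singleton_left.2 hi)) _ _
      (measurable_cylinderEvent_apply (mem_singleton i) (measurableSet_singleton e)) ht,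
    ← Measure.map_apply (measurable_pi_apply i) (measurableSet_singleton e),
    Measure.infinitePi_map_eval, uniformOn_univ, Measure.count_singleton,
    Nat.card_eq_fintype_card, one_div]

theorem iIndepFun_of_isUniformGiven {ι α : Type*} [LinearOrder α] [IsProbabilityMeasure μ]
    {E : ι → Type*} [∀ i, Finite (E i)] [∀ i, MeasurableSpace (E i)]
    [∀ i, DiscreteMeasurableSpace (E i)] {ρ : ι → α} (hρ : Function.Injective ρ)
    {𝓗 : ι → MeasurableSpace Ω} {W : ∀ i, Ω → E i} (hW : ∀ i, Measurable (W i))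
    (h : ∀ i, IsUniformGiven μ (𝓗 i) (W i)) (h𝓗 : ∀ i j, ρ i < ρ j → Measurable[𝓗 i] (W j)) :
    iIndepFun W μ :=
  iIndep_of_indep_of_lt hρ (fun i => (h i).indep (hW i)) fun i j hij => (h𝓗 i j hij).comap_le

end Independence

namespace IsUniformGiven

variable {Ω E : Type*} {m m' m0 : MeasurableSpace Ω} {μ : Measure Ω} {W : Ω → E}

theorem completion (h : IsUniformGiven μ m W) : IsUniformGiven μ (completion μ m) W := by
  intro e s hs
  obtain ⟨⟨t, ht, hst⟩, -⟩ := measurableSet_completion_iff.1 hs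
  rw [measure_congr hst, measure_congr ((ae_eq_refl (W ⁻¹' {e})).inter hst), h e t ht]

theorem of_indep [IsProbabilityMeasure μ] [MeasurableSpace E] [MeasurableSingletonClass E]
    (h : IsUniformGiven μ m W) (hind : Indep (MeasurableSpace.comap W inferInstance) m' μ) :
    IsUniformGiven μ m' W := by
  intro e s hs
  rw [(Indep_iff _ _ _).1 hind _ _ ⟨{e}, measurableSet_singleton e, rfl⟩ hs,
    h.measure_preimage_singleton]

end IsUniformGiven

section Past

variable {Ω κ α : Type*} [Preorder α] {E : κ → Type*} [∀ p, MeasurableSpace (E p)]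

/-- The σ-field generated by the members of the family `X` whose date, given by `ρ`, is at most
`a`. -/
@[reducible] def pastOf (ρ : κ → α) (X : ∀ p, Ω → E p) (a : α) : MeasurableSpace Ω :=
  ⨆ p, ⨆ (_ : ρ p ≤ a), MeasurableSpace.comap (X p) inferInstance

variable {ρ : κ → α} {X : ∀ p, Ω → E p} {a : α}

theorem pastOf_le_iff {m : MeasurableSpace Ω} :
    pastOf ρ X a ≤ m ↔ ∀ p, ρ p ≤ a → Measurable[m] (X p) := by
  simp only [pastOf, iSup₂_le_iff, measurable_iff_comap_le]

theorem measurable_pastOf {p : κ} (h : ρ p ≤ a) : Measurable[pastOf ρ X a] (X p) :=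
  pastOf_le_iff.1 le_rfl p h

theorem pastOf_mono : Monotone (pastOf ρ X) := fun _ _ h =>
  pastOf_le_iff.2 fun _ hp => measurable_pastOf (hp.trans h)

end Past

section Time

theorem NonposInt.le_prev_iff {m n : NonposInt} : m ≤ n.prev ↔ m < n := Int.le_sub_one_iff

theorem NonposInt.prev_lt (n : NonposInt) : n.prev < n := NonposInt.le_prev_iff.1 le_rfl

/-- The enumeration of `ℤ₋` by parity (`true` for the odd times) and rank: the time of `(b, k)` is
`-(2 * k + b)`. -/
def time : Bool × ℕ ≃ NonposInt :=
  Equiv.boolProdNatEquivNat.trans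
    { toFun k := ⟨-k, by lia⟩
      invFun n := n.1.natAbs
      left_inv _ := by simp
      right_inv n := Subtype.ext (by have := n.2; lia) }

theorem coe_time_false (k : ℕ) : (time (false, k)).1 = -(2 * k) := by
  change -((Nat.bit false k : ℕ) : ℤ) = _
  simp

theorem coe_time_true (k : ℕ) : (time (true, k)).1 = -(2 * k + 1) := by
  change -((Nat.bit true k : ℕ) : ℤ) = _
  simp

/-- The stage which immediately precedes a given one. -/
def prevStage : Bool × ℕ → Bool × ℕ
  | (false, k) => (true, k)
  | (true, k) => (false, k + 1)

theorem time_prevStage : ∀ p, time (prevStage p) = (time p).prev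
  | (false, k) => Subtype.ext <| by
    simp only [prevStage, NonposInt.prev, coe_time_false, coe_time_true]; lia
  | (true, k) => Subtype.ext <| by
    simp only [prevStage, NonposInt.prev, coe_time_false, coe_time_true]; lia

theorem time_true_lt_time_false (k : ℕ) : time (true, k) < time (false, k) :=
  time_prevStage (false, k) ▸ NonposInt.prev_lt _

theorem time_false_succ_lt_time_true (k : ℕ) : time (false, k + 1) < time (true, k) :=
  time_prevStage (true, k) ▸ NonposInt.prev_lt _

theorem time_false_le_of_ne {k : ℕ} {n : NonposInt} (h : time (true, k) ≤ n)
    (hne : time (true, k) ≠ n) : time (false, k) ≤ n := by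
  rw [← not_lt, ← NonposInt.le_prev_iff, ← time_prevStage (false, k)]
  exact (h.lt_of_ne hne).not_ge

end Time

section Source

/-- The space of families of letters, two of each rank. -/
abbrev Source : Type := ∀ p : Bool × ℕ, Alphabet p.2

/-- The law of independent uniform letters. -/
noncomputable def sourceMeasure : Measure Source := .infinitePi fun _ => uniformOn univ

instance : IsProbabilityMeasure sourceMeasure :=
  inferInstanceAs (IsProbabilityMeasure (.infinitePi _))

/-- The pair of letters of rank `k`. -/
def pairAt (k : ℕ) (ω : Source) : Alphabet k × Alphabet k := (ω (false, k), ω (true, k))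

/-- The part of the pair of rank `k` that is revealed first, one unit of time after the pair of
rank `k + 1`: the second letter, masked by the code. -/
noncomputable def firstStage (k : ℕ) (ω : Source) : Alphabet k :=
  ω (true, k) - code k (pairAt (k + 1) ω) (ω (false, k))

open Classical in
/-- Innovations that start afresh at each rank `k ∈ G`, where the second letter replaces its masked
version. -/
noncomputable def innovation (G : Set ℕ) : ∀ p : Bool × ℕ, Source → Alphabet p.2
  | (false, k), ω => ω (false, k)
  | (true, k), ω => if k ∈ G then ω (true, k) else firstStage k ω

variable {G : Set ℕ} {k : ℕ}

theorem innovation_of_mem (h : k ∈ G) : innovation G (true, k) = fun ω => ω (true, k) :=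
  funext fun _ => if_pos h

theorem innovation_of_notMem (h : k ∉ G) : innovation G (true, k) = firstStage k :=
  funext fun _ => if_neg h

theorem innovation_congr {G' : Set ℕ} : ∀ {p : Bool × ℕ}, (p.2 ∈ G ↔ p.2 ∈ G') →
    innovation G p = innovation G' p
  | (false, _), _ => rfl
  | (true, k), h => by
    by_cases hk : k ∈ G
    · rw [innovation_of_mem hk, innovation_of_mem (h.1 hk)]
    · rw [innovation_of_notMem hk, innovation_of_notMem (mt h.2 hk)]

variable {𝓗 : MeasurableSpace Source}

theorem measurable_pairAt (h₀ : Measurable[𝓗] fun ω : Source => ω (false, k))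
    (h₁ : Measurable[𝓗] fun ω : Source => ω (true, k)) : Measurable[𝓗] (pairAt k) :=
  h₀.prodMk h₁

theorem measurable_code (h : Measurable[𝓗] (pairAt (k + 1)))
    (h₀ : Measurable[𝓗] fun ω : Source => ω (false, k)) :
    Measurable[𝓗] fun ω => code k (pairAt (k + 1) ω) (ω (false, k)) :=
  (Measurable.of_discrete (f := fun q : (_ × _) × _ => code k q.1 q.2)).comp (h.prodMk h₀)

theorem measurable_firstStage (h : Measurable[𝓗] (pairAt (k + 1)))
    (h' : Measurable[𝓗] (pairAt k)) : Measurable[𝓗] (firstStage k) :=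
  h'.snd.sub (measurable_code h h'.fst)

theorem measurable_cylinderEvents_pairAt {s : Set (Bool × ℕ)} (h : ∀ b, (b, k) ∈ s) :
    Measurable[cylinderEvents s] (pairAt k) :=
  measurable_pairAt (measurable_cylinderEvent_apply (h false))
    (measurable_cylinderEvent_apply (h true))

/-- The order in which the innovations use up the letters, from the last to the first. -/
def letterOrder (p : Bool × ℕ) : ℕ ×ₗ Bool := toLex (p.2, !p.1)

theorem letterOrder_injective : Function.Injective letterOrder := fun ⟨_, _⟩ ⟨_, _⟩ h => by
  simpa [letterOrder, and_comm] using h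

theorem letterOrder_lt_of_snd_lt {p q : Bool × ℕ} (h : p.2 < q.2) :
    letterOrder p < letterOrder q :=
  Prod.Lex.toLex_lt_toLex.2 (.inl h)

theorem letterOrder_true_lt_letterOrder_false (k : ℕ) :
    letterOrder (true, k) < letterOrder (false, k) :=
  Prod.Lex.toLex_lt_toLex.2 (.inr ⟨rfl, Bool.false_lt_true⟩)

theorem measurable_code_cylinderEvents (k : ℕ) :
    Measurable[cylinderEvents {q | letterOrder (true, k) < letterOrder q}]
      fun ω : Source => code k (pairAt (k + 1) ω) (ω (false, k)) :=
  measurable_code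
    (measurable_cylinderEvents_pairAt fun _ => letterOrder_lt_of_snd_lt k.lt_succ_self)
    (measurable_cylinderEvent_apply (letterOrder_true_lt_letterOrder_false k))

theorem measurable_innovation_cylinderEvents (G : Set ℕ) (p : Bool × ℕ) {s : Set (Bool × ℕ)}
    (hs : {q | letterOrder p ≤ letterOrder q} ⊆ s) :
    Measurable[cylinderEvents s] (innovation G p) := by
  have hp : Measurable[cylinderEvents s] fun ω : Source => ω p :=
    measurable_cylinderEvent_apply (hs (le_refl (letterOrder p)))
  match p with
  | (false, _) => exact hp
  | (true, k) =>
    by_cases hk : k ∈ G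
    · rwa [innovation_of_mem hk]
    · rw [innovation_of_notMem hk]
      refine hp.sub ((measurable_code_cylinderEvents k).mono (cylinderEvents_mono ?_) le_rfl)
      exact fun q (hq : _ < letterOrder q) => hs hq.le

theorem measurable_innovation (G : Set ℕ) (p : Bool × ℕ) :
    Measurable[MeasurableSpace.pi] (innovation G p) :=
  (measurable_innovation_cylinderEvents G p (subset_univ _)).mono cylinderEvents_le_pi le_rfl

theorem isUniformGiven_innovation_cylinderEvents (G : Set ℕ) (p : Bool × ℕ) :
    IsUniformGiven sourceMeasure (cylinderEvents {q | letterOrder p < letterOrder q})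
      (innovation G p) := by
  have hp : IsUniformGiven sourceMeasure (cylinderEvents {q | letterOrder p < letterOrder q})
      fun ω => ω p := isUniformGiven_infinitePi (lt_irrefl (letterOrder p))
  match p with
  | (false, _) => exact hp
  | (true, k) =>
    by_cases hk : k ∈ G
    · rwa [innovation_of_mem hk]
    · rw [innovation_of_notMem hk]
      exact hp.sub cylinderEvents_le_pi (measurable_code_cylinderEvents k)

theorem iIndepFun_innovation (G : Set ℕ) : iIndepFun (innovation G) sourceMeasure :=
  iIndepFun_of_isUniformGiven letterOrder_injective (measurable_innovation G)
    (isUniformGiven_innovation_cylinderEvents G) fun _ q hpq =>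
    measurable_innovation_cylinderEvents G q fun _ hr => hpq.trans_le hr

theorem indep_innovation_pastOf (G : Set ℕ) (p : Bool × ℕ) :
    Indep (MeasurableSpace.comap (innovation G p) inferInstance)
      (pastOf time (innovation G) (time p).prev) sourceMeasure := by
  have h := indep_iSup_of_disjoint (fun q => (measurable_innovation G q).comap_le)
    (iIndepFun_innovation G).iIndep (S := {p}) (T := {q | time q ≤ (time p).prev})
    (disjoint_singleton_left.2 (NonposInt.prev_lt _).not_ge)
  rwa [iSup_singleton] at h

end Source

section State

/-- The values of the process at a stage. -/
abbrev State : Bool × ℕ → Type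
  | (false, k) => Alphabet k × Alphabet k
  | (true, k) => (Alphabet (k + 1) × Alphabet (k + 1)) × Alphabet k

instance : ∀ p, Finite (State p)
  | (false, _) => inferInstanceAs (Finite (_ × _))
  | (true, _) => inferInstanceAs (Finite (_ × _))

instance : ∀ p, MeasurableSpace (State p)
  | (false, _) => inferInstanceAs (MeasurableSpace (_ × _))
  | (true, _) => inferInstanceAs (MeasurableSpace (_ × _))

instance : ∀ p, DiscreteMeasurableSpace (State p)
  | (false, _) => inferInstanceAs (DiscreteMeasurableSpace (_ × _))
  | (true, _) => inferInstanceAs (DiscreteMeasurableSpace (_ × _))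

/-- The process, indexed by its stages. -/
noncomputable def state : ∀ p, Source → State p
  | (false, k), ω => pairAt k ω
  | (true, k), ω => (pairAt (k + 1) ω, firstStage k ω)

/-- The state at a stage, given the previous state and the innovation. -/
noncomputable def update : ∀ p, State (prevStage p) → Alphabet p.2 → State p
  | (false, k), (x, y), u => (u, y + code k x u)
  | (true, _), x, u => (x, u)

theorem state_eq_update : ∀ p ω,
    state p ω = update p (state (prevStage p) ω) (innovation ∅ p ω)
  | (false, _), _ => Prod.ext rfl (sub_add_cancel _ _).symm
  | (true, _), _ => Prod.ext rfl (if_neg (notMem_empty _)).symm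

variable {𝓗 : MeasurableSpace Source} {G : Set ℕ} {n : NonposInt}

theorem measurable_pairAt_pastOf_state {k : ℕ} (h : time (false, k) ≤ n) :
    Measurable[pastOf time state n] (pairAt k) :=
  measurable_pastOf (X := state) h

theorem pastOf_innovation_le (hG : ∀ k ∈ G, time (true, k) ≠ n) :
    pastOf time (innovation G) n ≤ pastOf time state n := by
  refine pastOf_le_iff.2 fun p hp => ?_
  match p with
  | (false, k) => exact (measurable_pairAt_pastOf_state hp).fst
  | (true, k) =>
    by_cases hk : k ∈ G
    · rw [innovation_of_mem hk]
      exact (measurable_pairAt_pastOf_state (time_false_le_of_ne hp (hG k hk))).snd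
    · rw [innovation_of_notMem hk]
      exact (measurable_pastOf (X := state) hp).snd

theorem measurable_pairAt_of_innovation {k : ℕ} (h : ∀ b, Measurable[𝓗] (innovation G (b, k)))
    (hsucc : k ∉ G → Measurable[𝓗] (pairAt (k + 1))) : Measurable[𝓗] (pairAt k) := by
  refine measurable_pairAt (h false) ?_
  by_cases hk : k ∈ G
  · exact innovation_of_mem hk ▸ h true
  · have h₁ := (h true).add (measurable_code (hsucc hk) (h false))
    simpa only [innovation_of_notMem hk, firstStage, Pi.add_def, innovation, sub_add_cancel]
      using h₁

theorem measurable_pairAt_pastOf_innovation (hG : G.Infinite) {k : ℕ}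
    (hk : time (false, k) ≤ n) :
    Measurable[pastOf time (innovation G) n] (pairAt k) := by
  have hinn {i : ℕ} (hi : time (false, i) ≤ n) (b : Bool) :
      Measurable[pastOf time (innovation G) n] (innovation G (b, i)) := by
    refine measurable_pastOf ?_
    cases b
    · exact hi
    · exact (time_true_lt_time_false i).le.trans hi
  obtain ⟨j, hj, hkj⟩ := hG.exists_gt k
  replace hkj := hkj.le
  induction hkj using Nat.decreasingInduction with
  | self => exact measurable_pairAt_of_innovation (hinn hk) fun h => absurd hj h
  | of_succ i _ ih =>
    refine measurable_pairAt_of_innovation (hinn hk) fun _ => ih ?_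
    exact ((time_false_succ_lt_time_true i).trans (time_true_lt_time_false i)).le.trans hk

theorem pastOf_state_le (hG : G.Infinite) (hn : ∀ k ∈ G, time (true, k) ≠ n) :
    pastOf time state n ≤ pastOf time (innovation G) n := by
  refine pastOf_le_iff.2 fun p hp => ?_
  match p with
  | (false, k) => exact measurable_pairAt_pastOf_innovation hG hp
  | (true, k) =>
    have h := measurable_pairAt_pastOf_innovation hG ((time_false_succ_lt_time_true k).le.trans hp)
    refine h.prodMk ?_
    by_cases hk : k ∈ G
    · exact measurable_firstStage h
        (measurable_pairAt_pastOf_innovation hG (time_false_le_of_ne hp (hn k hk)))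
    · exact innovation_of_notMem hk ▸ measurable_pastOf (X := innovation G) hp

theorem measurable_innovation_pastOf_state {p : Bool × ℕ} (h : time p ≤ n) :
    Measurable[pastOf time state n] (innovation ∅ p) :=
  (measurable_pastOf h).mono (pastOf_innovation_le fun _ => False.elim) le_rfl

theorem pastOf_state_time (p : Bool × ℕ) : pastOf time state (time p) =
    pastOf time state (time p).prev ⊔ MeasurableSpace.comap (innovation ∅ p) inferInstance := by
  refine le_antisymm (pastOf_le_iff.2 fun q hq => ?_)
    (sup_le (pastOf_mono (NonposInt.prev_lt _).le)
      (measurable_innovation_pastOf_state le_rfl).comap_le)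
  obtain hq | hq := hq.lt_or_eq
  · exact (measurable_pastOf (NonposInt.le_prev_iff.2 hq)).mono le_sup_left le_rfl
  · obtain rfl := time.injective hq
    rw [funext (state_eq_update q)]
    refine (Measurable.of_discrete (f := fun x : State _ × Alphabet _ => update q x.1 x.2)).comp
      (Measurable.prodMk ?_ (measurable_iff_comap_le.2 le_sup_right))
    exact (measurable_pastOf (time_prevStage q).le).mono le_sup_left le_rfl

theorem isUniformGiven_innovation (p : Bool × ℕ) :
    IsUniformGiven sourceMeasure (pastOf time state (time p).prev) (innovation ∅ p) := by
  have hp : innovation ∅ p = innovation (Ioi p.2) p := innovation_congr (by simp)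
  rw [hp]
  refine (isUniformGiven_innovation_cylinderEvents _ p).of_indep
    (indep_of_indep_of_le_right (indep_innovation_pastOf _ p) (pastOf_state_le (Ioi_infinite _) ?_))
  intro k hk h
  rw [← time_prevStage, time.injective.eq_iff] at h
  match p with
  | (false, j) =>
    obtain rfl : k = j := congrArg Prod.snd h
    exact lt_irrefl k hk
  | (true, j) => exact absurd (congrArg Prod.fst h) (by simp [prevStage])

end State

section Markov

variable {Ω X U : Type*} {m₁ m m0 : MeasurableSpace Ω} {μ : Measure Ω} [IsProbabilityMeasure μ]
  [MeasurableSpace X] [DiscreteMeasurableSpace X] [MeasurableSpace U]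
  [DiscreteMeasurableSpace U] {A : Ω → X} {V : Ω → U}

theorem condExp_preimage_prodMk_ae_eq [Fintype U] (hm : m ≤ m0) (hA : Measurable[m] A)
    (hV : Measurable V) (hind : Indep (MeasurableSpace.comap V inferInstance) m μ)
    (C : Set (X × U)) :
    μ⟦(fun ω => (A ω, V ω)) ⁻¹' C | m⟧ =ᵐ[μ] fun ω =>
      ∑ u, (A ⁻¹' {x | (x, u) ∈ C}).indicator (fun _ => μ.real (V ⁻¹' {u})) ω := by
  classical
  have hVu (u : U) : Integrable ((V ⁻¹' {u}).indicator fun _ => (1 : ℝ)) μ :=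
    (integrable_const 1).indicator (hV (measurableSet_singleton u))
  have hAu (u : U) : MeasurableSet[m] (A ⁻¹' {x | (x, u) ∈ C}) := hA .of_discrete
  have hsum : ((fun ω => (A ω, V ω)) ⁻¹' C).indicator (fun _ => (1 : ℝ)) =
      ∑ u, (A ⁻¹' {x | (x, u) ∈ C}).indicator ((V ⁻¹' {u}).indicator fun _ => 1) := by
    ext ω
    rw [Finset.sum_apply, Finset.sum_eq_single (V ω)]
    · simp [indicator_apply]
    · intro u _ hu
      simp [hu.symm]
    · simp
  have hterm (u : U) : μ[(A ⁻¹' {x | (x, u) ∈ C}).indicator ((V ⁻¹' {u}).indicator fun _ => 1) | m]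
      =ᵐ[μ] (A ⁻¹' {x | (x, u) ∈ C}).indicator fun _ => μ.real (V ⁻¹' {u}) := by
    refine (condExp_indicator (hVu u) (hAu u)).trans ?_
    have h := condExp_indep_eq hV.comap_le hm
      (StronglyMeasurable.indicator (@stronglyMeasurable_const _ _ (_) _ (1 : ℝ))
        ⟨{u}, measurableSet_singleton u, rfl⟩) hind
    rw [integral_indicator_const _ (hV (measurableSet_singleton u)), smul_eq_mul, mul_one] at h
    filter_upwards [h] with ω hω
    simp only [indicator, hω]
  rw [hsum]
  refine (condExp_finsetSum (fun u _ => (hVu u).indicator (hm _ (hAu u))) m).trans ?_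
  filter_upwards [eventually_all.2 hterm] with ω hω
  rw [Finset.sum_apply]
  exact Finset.sum_congr rfl fun u _ => hω u

theorem condExp_preimage_prodMk_ae_eq_of_le [Finite U] (hm₁ : m₁ ≤ m) (hm : m ≤ m0)
    (hA : Measurable[m₁] A) (hV : Measurable V)
    (hind : Indep (MeasurableSpace.comap V inferInstance) m μ) (C : Set (X × U)) :
    μ⟦(fun ω => (A ω, V ω)) ⁻¹' C | m⟧ =ᵐ[μ] μ⟦(fun ω => (A ω, V ω)) ⁻¹' C | m₁⟧ :=
  have := Fintype.ofFinite U
  (condExp_preimage_prodMk_ae_eq hm (hA.mono hm₁ le_rfl) hV hind C).trans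
    (condExp_preimage_prodMk_ae_eq (hm₁.trans hm) hA hV
      (indep_of_indep_of_le_right hind hm₁) C).symm

end Markov

theorem isAdicFiltration_of_isUniformGiven {Ω : Type*} {m0 : MeasurableSpace Ω} {μ : Measure Ω}
    [IsProbabilityMeasure μ] {ℱ : Filtration NonposInt m0} {E : NonposInt → Type*}
    [∀ n, Finite (E n)] [∀ n, Nonempty (E n)] [∀ n, MeasurableSpace (E n)]
    [∀ n, DiscreteMeasurableSpace (E n)] {W : ∀ n, Ω → E n} (hW : ∀ n, Measurable (W n))
    (hunif : ∀ n, IsUniformGiven μ (ℱ n.prev) (W n))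
    (hsup : ∀ n, ℱ n = completion μ (ℱ n.prev ⊔ MeasurableSpace.comap (W n) inferInstance)) :
    IsAdicFiltration μ ℱ fun n => Nat.card (E n) := by
  intro n
  let e := Finite.equivFin (E n)
  have he : MeasurableSpace.comap (e ∘ W n) inferInstance =
      MeasurableSpace.comap (W n) inferInstance := by
    rw [← MeasurableSpace.comap_comp]
    exact congrArg _ (MeasurableEmbedding.comap_eq
      ⟨e.injective, .of_discrete, fun _ _ => .of_discrete⟩)
  refine ⟨Nat.card_pos, e ∘ W n, Measurable.of_discrete.comp (hW n), fun i => ?_, ?_, ?_⟩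
  · rw [← (hunif n).measure_preimage_singleton (e.symm i), preimage_comp,
      ← e.image_symm_eq_preimage, image_singleton]
  · rw [he]
    exact (hunif n).indep (hW n)
  · rw [he]
    exact hsup n

section NaturalFiltration

/-- The process, indexed by time. -/
noncomputable def process (n : NonposInt) : Source → State (time.symm n) := state (time.symm n)

theorem naturalFiltration_process (n : NonposInt) :
    (naturalFiltration sourceMeasure process n : MeasurableSpace Source) =
      completion sourceMeasure (pastOf time state n) :=
  congrArg (completion sourceMeasure) <| time.symm.iSup_congr fun j => by
    rw [time.apply_symm_apply, process]

theorem measurable_state (p : Bool × ℕ) : Measurable[MeasurableSpace.pi] (state p) := by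
  have hpair (k : ℕ) : Measurable (pairAt k) :=
    measurable_pairAt (measurable_pi_apply _) (measurable_pi_apply _)
  match p with
  | (false, k) => exact hpair k
  | (true, k) => exact (hpair (k + 1)).prodMk (measurable_firstStage (hpair (k + 1)) (hpair k))

theorem pastOf_state_le_pi (n : NonposInt) : pastOf time state n ≤ MeasurableSpace.pi :=
  pastOf_le_iff.2 fun p _ => measurable_state p

theorem measurable_process (n : NonposInt) : Measurable (process n) := measurable_state _

theorem measurable_naturalFiltration_process_of_state {X : Type*} [MeasurableSpace X]
    {n : NonposInt} {f : Source → X} (h : Measurable[pastOf time state n] f) :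
    Measurable[naturalFiltration sourceMeasure process n] f := by
  rw [naturalFiltration_process]
  exact h.mono (le_completion (pastOf_state_le_pi n)) le_rfl

theorem measurable_process_naturalFiltration (n : NonposInt) :
    Measurable[naturalFiltration sourceMeasure process n] (process n) :=
  measurable_naturalFiltration_process_of_state (measurable_pastOf (time.apply_symm_apply n).le)

theorem time_symm_prev (n : NonposInt) : time.symm n.prev = prevStage (time.symm n) := by
  rw [Equiv.symm_apply_eq, time_prevStage, Equiv.apply_symm_apply]

theorem isUniformGiven_naturalFiltration_process (n : NonposInt) :
    IsUniformGiven sourceMeasure (naturalFiltration sourceMeasure process n.prev)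
      (innovation ∅ (time.symm n)) := by
  rw [naturalFiltration_process]
  simpa only [time.apply_symm_apply] using (isUniformGiven_innovation (time.symm n)).completion

theorem naturalFiltration_process_eq_sup (n : NonposInt) :
    (naturalFiltration sourceMeasure process n : MeasurableSpace Source) =
      completion sourceMeasure (naturalFiltration sourceMeasure process n.prev ⊔
        MeasurableSpace.comap (innovation ∅ (time.symm n)) inferInstance) := by
  rw [naturalFiltration_process, naturalFiltration_process,
    completion_sup (pastOf_state_le_pi _) (measurable_innovation _ _).comap_le]
  simpa only [time.apply_symm_apply] using
    congrArg (completion sourceMeasure) (pastOf_state_time (time.symm n))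

theorem process_eq_of_prev {n : NonposInt} {ω ω' : Source}
    (h : process n.prev ω = process n.prev ω')
    (h' : innovation ∅ (time.symm n) ω = innovation ∅ (time.symm n) ω') :
    process n ω = process n ω' := by
  have key : ∀ q, q = prevStage (time.symm n) → state q ω = state q ω' →
      process n ω = process n ω' := by
    rintro _ rfl h
    rw [process, state_eq_update, h, h', ← state_eq_update]
  exact key _ (time_symm_prev n) h

theorem isMarkov_process : IsMarkov sourceMeasure process := by
  intro n B _
  have := Fintype.ofFinite (Alphabet (time.symm n).2)
  have hB : process n ⁻¹' B = (fun ω => (process n.prev ω, innovation ∅ (time.symm n) ω)) ⁻¹'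
      ((fun ω => (process n.prev ω, innovation ∅ (time.symm n) ω)) '' (process n ⁻¹' B)) := by
    refine (subset_preimage_image _ _).antisymm ?_
    rintro ω ⟨ω', hω', h⟩
    rwa [mem_preimage, process_eq_of_prev (congrArg Prod.fst h).symm (congrArg Prod.snd h).symm]
  have hV := measurable_innovation ∅ (time.symm n)
  rw [hB]
  exact condExp_preimage_prodMk_ae_eq_of_le (measurable_process_naturalFiltration _).comap_le
    (Filtration.le _ _) (comap_measurable _) hV
    ((isUniformGiven_naturalFiltration_process n).indep hV) _

theorem isAdicFiltration_process :
    IsAdicFiltration sourceMeasure (naturalFiltration sourceMeasure process)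
      fun n => Nat.card (Alphabet (time.symm n).2) :=
  isAdicFiltration_of_isUniformGiven (fun _ => measurable_innovation _ _)
    isUniformGiven_naturalFiltration_process naturalFiltration_process_eq_sup

theorem time_symm_even (n : NonposInt) : time.symm n.even = (false, n.1.natAbs) := by
  rw [Equiv.symm_apply_eq, Subtype.ext_iff, coe_time_false, NonposInt.even]
  have := n.2
  lia

theorem time_symm_evenPrev (n : NonposInt) : time.symm n.evenPrev = (false, n.1.natAbs + 1) := by
  rw [Equiv.symm_apply_eq, Subtype.ext_iff, coe_time_false, NonposInt.evenPrev]
  have := n.2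
  lia

theorem time_symm_odd (n : NonposInt) : time.symm n.odd = (true, n.1.natAbs) := by
  rw [Equiv.symm_apply_eq, Subtype.ext_iff, coe_time_true, NonposInt.odd]
  have := n.2
  lia

theorem exists_process_odd_eq (n : NonposInt) :
    ∃ g : State (time.symm n.evenPrev) × State (time.symm n.even) → State (time.symm n.odd),
      ∀ ω, process n.odd ω = g (process n.evenPrev ω, process n.even ω) := by
  simp only [process]
  rw [time_symm_evenPrev, time_symm_even, time_symm_odd]
  exact ⟨fun z => (z.1, z.2.2 - code _ z.1 z.2.1), fun _ => rfl⟩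

theorem iIndepFun_pairAt : iIndepFun pairAt sourceMeasure :=
  iIndep_of_indep_of_lt (ρ := id) Function.injective_id
    (𝓗 := fun k => cylinderEvents {q | k < q.2})
    (fun k => indep_of_indep_of_le_left
      (indep_cylinderEvents_infinitePi _ <| disjoint_left.2 fun _ (h : _ = k) => h.not_gt)
      (measurable_cylinderEvents_pairAt fun _ => rfl).comap_le)
    fun _ _ h => (measurable_cylinderEvents_pairAt fun _ => h).comap_le

theorem iIndepFun_process_even :
    iIndepFun (fun n : NonposInt => process n.even) sourceMeasure := by
  have hcomap (n : NonposInt) : MeasurableSpace.comap (process n.even) inferInstance =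
      MeasurableSpace.comap (pairAt n.1.natAbs) inferInstance := by
    rw [process, time_symm_even]
    rfl
  rw [iIndepFun_iff_iIndep, funext hcomap]
  refine (iIndepFun_pairAt.precomp (g := fun n : NonposInt => n.1.natAbs) ?_).iIndep
  intro a b h
  have ha := a.2
  have hb := b.2
  exact Subtype.ext (by lia)

end NaturalFiltration

section ProductType

variable {Ω ι κ α : Type*} {m0 : MeasurableSpace Ω} {μ : Measure Ω} [LinearOrder ι] [LinearOrder α]
  {E : κ → Type*} [∀ p, MeasurableSpace (E p)] {ρ : κ → α} {X : ∀ p, Ω → E p} {φ : ι → α}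

theorem exists_isLeast_setOf_le [LocallyFiniteOrder α] (hφ : StrictMono φ) {a : α} {i : ι}
    (h : a ≤ φ i) : ∃ j ≤ i, IsLeast {j | a ≤ φ j} j := by
  obtain ⟨j, ⟨hj, hji⟩, hmin⟩ :=
    ((finite_Icc a (φ i)).preimage hφ.injective.injOn).exists_minimal ⟨i, h, le_rfl⟩
  rw [hφ.le_iff_le] at hji
  refine ⟨j, hji, hj, fun l hl => ?_⟩
  obtain hlj | hlj := le_total l j
  · exact hmin ⟨hl, hφ.monotone (hlj.trans hji)⟩ hlj
  · exact hlj

theorem exists_covBy_le_of_strictMono [LocallyFiniteOrder α] (hφ : StrictMono φ) {i j : ι}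
    (h : i < j) : ∃ l, i ⋖ l ∧ l ≤ j := by
  let _ := (OrderEmbedding.ofStrictMono φ hφ).locallyFiniteOrder
  let _ := LinearLocallyFiniteOrder.succOrder ι
  exact exists_covBy_le_of_lt h

/-- The family of those members of `X` whose date is at most `φ i` but exceeds every `φ j` with
`j < i`, encoded as one real variable. -/
noncomputable def blockVariable [Countable κ] [∀ p, StandardBorelSpace (E p)] (ρ : κ → α)
    (X : ∀ p, Ω → E p) (φ : ι → α) (i : ι) : Ω → ℝ :=
  embeddingReal (∀ p : {p | IsLeast {j | ρ p ≤ φ j} i}, E p) ∘ fun ω p => X p ω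

section Block

variable [Countable κ] [∀ p, StandardBorelSpace (E p)]

theorem comap_blockVariable (i : ι) : MeasurableSpace.comap (blockVariable ρ X φ i) inferInstance =
    ⨆ p ∈ {p | IsLeast {j | ρ p ≤ φ j} i}, MeasurableSpace.comap (X p) inferInstance := by
  rw [blockVariable, ← MeasurableSpace.comap_comp,
    (measurableEmbedding_embeddingReal (∀ p : {p | IsLeast {j | ρ p ≤ φ j} i}, E p)).comap_eq,
    MeasurableSpace.pi, MeasurableSpace.comap_iSup, iSup_subtype']
  simp only [MeasurableSpace.comap_comp]
  rfl

theorem iSup_comap_blockVariable [LocallyFiniteOrder α] (hφ : StrictMono φ) (i : ι) :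
    ⨆ j, ⨆ (_ : j ≤ i), MeasurableSpace.comap (blockVariable ρ X φ j) inferInstance =
      pastOf ρ X (φ i) := by
  simp only [comap_blockVariable]
  refine le_antisymm (iSup₂_le fun j hj => iSup₂_le fun p hp =>
    (measurable_pastOf (hp.1.trans (hφ.monotone hj))).comap_le) (iSup₂_le fun p hp => ?_)
  obtain ⟨j, hj, hpj⟩ := exists_isLeast_setOf_le hφ hp
  exact le_iSup₂_of_le j hj (le_iSup₂_of_le p hpj le_rfl)

theorem iIndepFun_blockVariable [IsProbabilityMeasure μ] (hX : ∀ p, Measurable (X p))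
    (hind : iIndepFun X μ) : iIndepFun (blockVariable ρ X φ) μ := by
  refine iIndep_of_indep_of_lt (ρ := id) Function.injective_id
    (𝓗 := fun i => ⨆ p ∈ {p | ∃ j, i < j ∧ IsLeast {j | ρ p ≤ φ j} j},
      MeasurableSpace.comap (X p) inferInstance) (fun i => ?_) fun i j hij => ?_
  · rw [comap_blockVariable]
    refine indep_iSup_of_disjoint (fun p => (hX p).comap_le) hind.iIndep (disjoint_left.2 ?_)
    rintro p hp ⟨j, hij, hpj⟩
    exact hij.ne (hp.unique hpj)
  · rw [comap_blockVariable]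
    exact biSup_mono fun p hp => ⟨j, hij, hp⟩

theorem isProductType_of_forall_eq_completion_pastOf [LocallyFiniteOrder α]
    [IsProbabilityMeasure μ] {ℱ : Filtration ι m0} (hX : ∀ p, Measurable (X p))
    (hind : iIndepFun X μ) (hφ : StrictMono φ) (hℱ : ∀ i, ℱ i = completion μ (pastOf ρ X (φ i))) :
    IsProductType μ ℱ := by
  refine ⟨blockVariable ρ X φ, fun i => ?_, iIndepFun_blockVariable hX hind,
    Filtration.ext (funext fun i => ?_)⟩
  · rw [measurable_iff_comap_le, comap_blockVariable]
    exact iSup₂_le fun p _ => (hX p).comap_le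
  · exact (hℱ i).trans (congrArg (completion μ) (iSup_comap_blockVariable hφ i).symm)

end Block

end ProductType

section Standard

variable {Ω ι : Type*} [Preorder ι] {m m₁ m0 : MeasurableSpace Ω} {μ : Measure Ω}

theorem condIndepGiven_self_right [IsFiniteMeasure μ] (hm : m ≤ m0) (hm₁ : m₁ ≤ m0) :
    CondIndepGiven μ m m₁ m := by
  intro s t hs ht
  have hs_int : Integrable (s.indicator fun _ => (1 : ℝ)) μ :=
    (integrable_const _).indicator (hm₁ s hs)
  have h₁ : (s ∩ t).indicator (fun _ => (1 : ℝ)) = t.indicator (s.indicator fun _ => 1) := by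
    rw [indicator_indicator, inter_comm]
  have h₂ : μ⟦t | m⟧ = t.indicator fun _ => (1 : ℝ) :=
    condExp_of_stronglyMeasurable hm ((@stronglyMeasurable_const _ _ m _ _).indicator ht)
      ((integrable_const _).indicator (hm t ht))
  rw [h₁, h₂]
  filter_upwards [condExp_indicator hs_int ht] with ω hω
  rw [hω, Pi.mul_apply]
  by_cases h : ω ∈ t <;> simp [h]

theorem measurable_completion_of_mem_L0 {X : Ω →ₘ[μ] ℝ} (hX : X ∈ L0 m μ) :
    Measurable[completion μ m] X := by
  obtain ⟨f, hf, hXf⟩ : AEStronglyMeasurable[m] X μ := hX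
  refine fun B hB => measurableSet_completion_iff.2
    ⟨⟨f ⁻¹' B, hf.measurable hB, ?_⟩, X.stronglyMeasurable.measurable hB⟩
  filter_upwards [hXf] with ω hω
  exact congrArg (· ∈ B) hω

theorem completion_iSup_comap_L0 (ℱ : Filtration ι m0) (i : ι) :
    completion μ (⨆ X : L0 (⨆ i, ℱ i) μ, ⨆ (_ : X.1 ∈ L0 (ℱ i) μ),
      MeasurableSpace.comap (X.1 : Ω → ℝ) (borel ℝ)) = completion μ (ℱ i) := by
  rw [← BorelSpace.measurable_eq (α := ℝ)]
  refine le_antisymm ?_ fun S hS => ?_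
  · conv_rhs => rw [← completion_completion]
    exact completion_mono (iSup₂_le fun X hX => (measurable_completion_of_mem_L0 hX).comap_le)
  · obtain ⟨⟨T, hT, hST⟩, hS⟩ := measurableSet_completion_iff.1 hS
    have hTm := FiltrationIso.measurable_mem_of_measurableSet hT
    let X : L0 (⨆ i, ℱ i) μ := FiltrationIso.encode (· ∈ T) (hTm.mono (le_iSup ℱ i) le_rfl)
    have hX : X.1 =ᵐ[μ] embeddingReal Prop ∘ (· ∈ T) := FiltrationIso.coe_encode_ae_eq _ _
    refine measurableSet_completion_iff.2 ⟨⟨(X.1 : Ω → ℝ) ⁻¹' {embeddingReal Prop True},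
      le_iSup₂ (f := fun (X : L0 (⨆ i, ℱ i) μ) (_ : X.1 ∈ L0 (ℱ i) μ) =>
        MeasurableSpace.comap (X.1 : Ω → ℝ) inferInstance) X (FiltrationIso.encode_mem_L0 hTm) _
        ⟨_, measurableSet_singleton _, rfl⟩, hST.trans ?_⟩, hS⟩
    filter_upwards [hX] with ω hω
    rw [eq_iff_iff]
    change ω ∈ T ↔ X.1 ω = embeddingReal Prop True
    rw [hω, Function.comp_apply, (measurableEmbedding_embeddingReal Prop).injective.eq_iff,
      eq_iff_iff, iff_true]

/-- The identity, as an isomorphism of a complete filtration onto itself. -/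
noncomputable def FiltrationIso.refl (μ : Measure Ω) (ℱ : Filtration ι m0)
    (hℱ : ∀ i, completion μ (ℱ i) = ℱ i) : FiltrationIso μ μ ℱ ℱ where
  toEquiv := Equiv.refl _
  map_law _ := rfl
  comm_borel _ _ _ _ h := h
  generate i := (completion_iSup_comap_L0 ℱ i).trans (hℱ i)

theorem IsProductType.isStandard {Ω : Type} {m0 : MeasurableSpace Ω} {μ : Measure Ω}
    [IsProbabilityMeasure μ] {ℱ : Filtration ι m0} (h : IsProductType μ ℱ) : IsStandard μ ℱ := by
  have hℱ (i : ι) : completion μ (ℱ i) = ℱ i := by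
    obtain ⟨V, -, -, rfl⟩ := h
    exact completion_completion
  exact ⟨Ω, m0, μ, ℱ, ℱ, inferInstance, ⟨.refl μ ℱ hℱ⟩,
    ⟨fun _ => le_rfl, fun k n _ => condIndepGiven_self_right (ℱ.le k) (ℱ.le n)⟩, h⟩

end Standard

section Extraction

theorem pairAt_preimage_inter (k : ℕ) (x : Alphabet k × Alphabet k) (S : Set Source) :
    pairAt k ⁻¹' {x} ∩ S = innovation ∅ (false, k) ⁻¹' {x.1} ∩
      (S ∩ {ω | x.2 - code k (pairAt (k + 1) ω) x.1 = firstStage k ω}) := by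
  ext ω
  simp only [mem_inter_iff, mem_preimage, mem_singleton_iff, mem_ofPred_eq, firstStage]
  constructor
  · rintro ⟨rfl, h⟩
    exact ⟨rfl, h, rfl⟩
  · rintro ⟨h₁, h₂, h₃⟩
    rw [show ω (false, k) = x.1 from h₁, sub_left_inj] at h₃
    exact ⟨Prod.ext h₁ h₃.symm, h₂⟩

theorem isTwoStage_process (k : ℕ) :
    IsTwoStage sourceMeasure (naturalFiltration sourceMeasure process (time (true, k)))
      (pairAt (k + 1)) (pairAt k) (firstStage k) (fun x z => z.2 - code k x z.1)
      (Nat.card (Alphabet k) : ℝ≥0)⁻¹ := by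
  have hstate := measurable_naturalFiltration_process_of_state
    (measurable_pastOf (X := state) (le_refl (time (true, k))))
  refine ⟨Filtration.le _ _, hstate.fst, measurable_state (false, k), hstate.snd,
    .of_forall fun _ => rfl, fun x S hS => ?_⟩
  have hset : MeasurableSet[naturalFiltration sourceMeasure process (time (true, k))]
      {ω | x.2 - code k (pairAt (k + 1) ω) x.1 = firstStage k ω} :=
    hstate (MeasurableSet.of_discrete (s := {z : State (true, k) | x.2 - code k z.1 x.1 = z.2}))
  have hinn := isUniformGiven_naturalFiltration_process (time (false, k))
  rw [time.symm_apply_apply, ← time_prevStage] at hinn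
  rw [pairAt_preimage_inter, hinn _ _ (hS.inter hset)]
  simp

variable {ι : Type*} {φ : ι → NonposInt}

/-- The ranks of the odd times which the extraction `φ` skips. -/
def skippedRanks (φ : ι → NonposInt) : Set ℕ := {k | time (true, k) ∉ range φ}

theorem infinite_skippedRanks_iff :
    (skippedRanks φ).Infinite ↔ {n : NonposInt | n.odd ∉ range φ}.Infinite := by
  have hrank : Function.Bijective fun n : NonposInt => n.1.natAbs :=
    ⟨fun a b h => Subtype.ext (by have := a.2; have := b.2; lia), fun k => ⟨⟨-k, by lia⟩, by simp⟩⟩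
  have hskip : {n : NonposInt | n.odd ∉ range φ} =
      (fun n : NonposInt => n.1.natAbs) ⁻¹' skippedRanks φ := by
    ext n
    simp only [skippedRanks, mem_preimage, mem_ofPred_eq, ← time_symm_odd, Equiv.apply_symm_apply]
  rw [hskip, ← infinite_image_iff hrank.injective.injOn, image_preimage_eq _ hrank.surjective]

variable [LinearOrder ι]

theorem isProductType_reindex_process (hφ : StrictMono φ) (h : (skippedRanks φ).Infinite) :
    IsProductType sourceMeasure
      (reindex (naturalFiltration sourceMeasure process) φ hφ.monotone) := by
  refine isProductType_of_forall_eq_completion_pastOf (measurable_innovation (skippedRanks φ))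
    (iIndepFun_innovation _) hφ (ρ := time) fun i => ?_
  have hskip : ∀ k ∈ skippedRanks φ, time (true, k) ≠ φ i := fun k hk hi => hk ⟨i, hi.symm⟩
  exact (naturalFiltration_process (φ i)).trans (congrArg _ <|
    (pastOf_state_le h hskip).antisymm (pastOf_innovation_le hskip))

theorem not_isStandard_reindex_process (hφ : StrictMono φ) (h : (skippedRanks φ).Finite) :
    ¬ IsStandard sourceMeasure
      (reindex (naturalFiltration sourceMeasure process) φ hφ.monotone) := by
  obtain ⟨K, hK⟩ := h.bddAbove
  have hrange (k : ℕ) : ∃ i, φ i = time (true, K + 1 + k) :=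
    by_contra fun hk => by have := hK hk; lia
  choose t ht using hrange
  have ht_lt (k : ℕ) : t (k + 1) < t k := by
    rw [← hφ.lt_iff_lt, ht, ht]
    exact (time_true_lt_time_false _).trans (time_false_succ_lt_time_true _)
  choose s hts hst using fun k => exists_covBy_le_of_strictMono hφ (ht_lt k)
  refine not_isStandard_of_isTwoStage (t := fun k => t (k + 1)) (s := s)
    (A := fun k => pairAt (K + 1 + (k + 1))) hts (fun k => hst (k + 1)) (fun i => ?_)
    (fun k => ht (k + 1) ▸ isTwoStage_process (K + 1 + (k + 1))) (fun k => ?_)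
    (fun k _ _ => ncard_setOf_sub_code_eq_le (K + 1 + (k + 1)))
    (NNReal.summable_comp_injective summable_inv_card_alphabet
      fun _ _ h => Nat.succ_injective (Nat.add_left_cancel h))
  · filter_upwards [eventually_ge_atTop (φ i).1.natAbs] with N hN
    rw [← hφ.le_iff_le, ht, ← Subtype.coe_le_coe, coe_time_true]
    lia
  · have hlt : time (true, K + 1 + (k + 1)) < φ (s k) := ht (k + 1) ▸ hφ (hts k).lt
    exact measurable_naturalFiltration_process_of_state
      (measurable_pairAt_pastOf_state (time_false_le_of_ne hlt.le hlt.ne))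

theorem isStandard_reindex_process_iff (hφ : StrictMono φ) :
    IsStandard sourceMeasure (reindex (naturalFiltration sourceMeasure process) φ hφ.monotone) ↔
      {n : NonposInt | n.odd ∉ range φ}.Infinite := by
  rw [← infinite_skippedRanks_iff]
  exact ⟨fun h hfin => not_isStandard_reindex_process hφ hfin h,
    fun h => (isProductType_reindex_process hφ h).isStandard⟩

theorem NonposInt.odd_strictMono : StrictMono NonposInt.odd := fun _ _ (h : _ < (_ : ℤ)) =>
  show _ < (_ : ℤ) by simp only [NonposInt.odd]; lia

theorem isAtThreshold_process : IsAtThreshold sourceMeasure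
    (reindex (naturalFiltration sourceMeasure process) NonposInt.odd NonposInt.odd_mono) := by
  refine ⟨fun h => ?_, fun D _ => ?_⟩
  · simpa using (isStandard_reindex_process_iff NonposInt.odd_strictMono).1 h
  · have hD : {n : NonposInt | n.odd ∉ range (NonposInt.odd ∘ (Subtype.val : D → NonposInt))} =
        Dᶜ := by
      ext n
      simp only [range_comp, Subtype.range_coe, mem_ofPred_eq, mem_compl_iff,
        NonposInt.odd_strictMono.injective.mem_set_image]
    rw [← hD]
    exact isStandard_reindex_process_iff (NonposInt.odd_strictMono.comp (Subtype.strictMono_coe _))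

end Extraction

end BackwardFiltration

theorem mainTheorem1 :
    ∃ (Ω : Type) (_ : MeasurableSpace Ω) (μ : Measure Ω) (_ : IsProbabilityMeasure μ)
      (E : NonposInt → Type) (_ : ∀ n, Finite (E n))
      (_ : ∀ n, MeasurableSpace (E n)) (_ : ∀ n, DiscreteMeasurableSpace (E n))
      (Z : ∀ n, Ω → E n),
      (∀ n, Measurable (Z n)) ∧
      IsMarkov μ Z ∧
      iIndepFun (fun n : NonposInt => Z n.even) μ ∧
      (∀ n : NonposInt, ∃ g : E n.evenPrev × E n.even → E n.odd,
        ∀ ω, Z n.odd ω = g (Z n.evenPrev ω, Z n.even ω)) ∧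
      (∃ r : NonposInt → ℕ, IsAdicFiltration μ (naturalFiltration μ Z) r) ∧
      (∀ D : Set NonposInt, D.Infinite →
        (IsStandard μ (extract (naturalFiltration μ Z) D) ↔
          {n : NonposInt | n.odd ∉ D}.Infinite)) ∧
      IsAtThreshold μ
        (reindex (naturalFiltration μ Z) NonposInt.odd NonposInt.odd_mono) := by
  refine ⟨Source, inferInstance, sourceMeasure, inferInstance, fun n => State (time.symm n),
    fun _ => inferInstance, fun _ => inferInstance, fun _ => inferInstance, process,
    measurable_process, isMarkov_process, iIndepFun_process_even, exists_process_odd_eq,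
    ⟨_, isAdicFiltration_process⟩, fun D _ => ?_, isAtThreshold_process⟩
  have h := isStandard_reindex_process_iff (Subtype.strictMono_coe (· ∈ D))
  rwa [Subtype.range_coe] at h
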